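/- Notation. Write $\Gamma(z_1,\dots,z_m)=\Gamma(z_1)\cdots\Gamma(z_m)$. For $u\in\mathbb R$ and $x>0$ let $K_{\mathrm i u}(x)=\int_0^\infty e^{-x\cosh w}\cos(uw)\,dw$, and for $t>0$, $x,y\in\mathbb R$ let $$p_t(x,y)=\int_0^\infty e^{-tu^2}K_{\mathrm i u}(e^x)K_{\mathrm i u}(e^y)\,\frac{2}{\pi}\frac{du}{|\Gamma(\mathrm i u)|^2}.$$ Fix real $a,c$ with $a+c>0$ and $\tau>0$, and put $C^{(\tau)}_{a,c}=\int_{\mathbb R}\int_{\mathbb R}e^{ax+cy}p_\tau(x,y)\,dx\,dy$. The process $Y$. Let $(Y_t)_{t\in[0,\tau]}$ be a real-valued (Markov) process such that, for all $n\ge 0$ and $0=t_0<t_1<\dots<t_{n+1}=\tau$, the vector $(Y_{t_0},\dots,Y_{t_{n+1}})$ has the density $$f_{\mathbf t}(x_0,\dots,x_{n+1})=\frac{1}{C^{(\tau)}_{a,c}}\,e^{c x_0+a x_{n+1}}\prod_{k=1}^{n+1}p_{t_k-t_{k-1}}(x_{k-1},x_k).$$ The process $\mathbb T$. Let $(\mathbb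 T_s)_{-a<s<c}$ be the Markov process with state space $(0,\infty)$ whose transition probabilities, for $-a<s<t<c$ and $x>0$, have the density, at $y>0$, $$\mathfrak p_{s,t}(x,y)=\frac{\left|\Gamma\left(\frac{c-t+\mathrm i\sqrt y}{2},\frac{t-s+\mathrm i(\sqrt x+\sqrt y)}{2},\frac{t-s+\mathrm i(\sqrt x-\sqrt y)}{2}\right)\right|^2}{8\pi\sqrt y\,\Gamma(t-s)\left|\Gamma\left(\frac{c-s+\mathrm i\sqrt x}{2},\mathrm i\sqrt y\right)\right|^2}$$ (the continuous dual Hahn process). Here $\mathbb E[\,\cdot\mid\mathbb T_s=x]$ is the expectation for the process started at time $s$ from $x$. Theorem. Let $d\ge 0$, $c>s_1>\dots>s_d>s_{d+1}>-a$ and $0=t_0<t_1<\dots<t_d<t_{d+1}=\tau$. Then $$\int_0^\infty\mathbb E\left[\exp\left(-\sum_{k=1}^{d+1}(t_k-t_{k-1})\mathbb T_{s_k}\right)\,\middle|\,\mathbb T_{s_{d+1}}=x\right]\widetilde{\mathfrak p}_{s_{d+1}}(x)\,dx=\mathbb E\left[\exp\left(\sum_{k=1}^{d+1}s_k\,(Y_{t_k}-Y_{t_{k-1}})\right)\right],$$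 where, for $-a<s<c$ and $x>0$, $$\widetilde{\mathfrak p}_s(x)=\frac{2^{a+c}}{16\pi\,C^{(\tau)}_{a,c}}\,\frac{\left|\Gamma\left(\frac{a+s+\mathrm i\sqrt x}{2},\frac{c-s+\mathrm i\sqrt x}{2}\right)\right|^2}{\sqrt x\,|\Gamma(\mathrm i\sqrt x)|^2},$$ and all the integrals and expectations in this identity converge absolutely. The same identity, again with absolutely convergent integrals, holds when the two expectations are written out as integrals against the above densities: with $y_{d+1}=x$, $$\int_0^\infty\left(\int_{(0,\infty)^d}e^{-\sum_{k=1}^{d+1}(t_k-t_{k-1})y_k}\prod_{k=1}^d\mathfrak p_{s_{k+1},s_k}(y_{k+1},y_k)\,dy_1\cdots dy_d\right)\widetilde{\mathfrak p}_{s_{d+1}}(x)\,dx=\int_{\mathbb R^{d+2}}e^{\sum_{k=1}^{d+1}s_k(x_k-x_{k-1})}f_{\mathbf t}(x_0,\dots,x_{d+1})\,dx_0\cdots dx_{d+1}.$$ -/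

import Mathlib

open MeasureTheory Set

noncomputable section

namespace DualRep

/-- The modified Bessel function `K_{iu}(x) = ∫₀^∞ exp(-x cosh w) cos(u w) dw`
(for real `u` and `x > 0`). -/
def besselK (u x : ℝ) : ℝ :=
  ∫ w in Ioi (0 : ℝ), Real.exp (-(x * Real.cosh w)) * Real.cos (u * w)

/-- `|Γ(p + i q)|²` for real `p`, `q`. -/
def gammaSq (p q : ℝ) : ℝ :=
  ‖Complex.Gamma ((p : ℂ) + Complex.I * (q : ℂ))‖ ^ 2

/-- The Yakubovich heat kernel
`p_t(x,y) = ∫₀^∞ exp(-t u²) K_{iu}(e^x) K_{iu}(e^y) μ(du)`, `μ(du) = (2/π) |Γ(iu)|⁻² du`. -/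
def heatKernel (t x y : ℝ) : ℝ :=
  ∫ u in Ioi (0 : ℝ),
    Real.exp (-(t * u ^ 2)) * besselK u (Real.exp x) * besselK u (Real.exp y) *
      (2 / (Real.pi * gammaSq 0 u))

/-- The normalizing constant `C = ∫∫ exp(a x + c y) p_τ(x,y) dx dy`. -/
def normConst (a c τ : ℝ) : ℝ :=
  ∫ y : ℝ, ∫ x : ℝ, Real.exp (a * x + c * y) * heatKernel τ x y

/-- The joint density
`f_t(x) = C⁻¹ exp(c x₀ + a x_{n+1}) ∏_{k=1}^{n+1} p_{t_k - t_{k-1}}(x_{k-1}, x_k)`. -/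
def jointDensityY (a c τ : ℝ) {n : ℕ} (t : Fin (n + 2) → ℝ) (x : Fin (n + 2) → ℝ) : ℝ :=
  (normConst a c τ)⁻¹ * Real.exp (c * x 0 + a * x (Fin.last (n + 1))) *
    ∏ k : Fin (n + 1), heatKernel (t k.succ - t k.castSucc) (x k.castSucc) (x k.succ)

/-- The random vector `X` has density `f` with respect to Lebesgue measure under `P`:
`f` is integrable and `P(X ∈ B) = ∫_B f` for all Borel sets `B`. -/
def HasDensity {Ω : Type*} [MeasurableSpace Ω] (P : Measure Ω) {n : ℕ}
    (X : Ω → Fin n → ℝ) (f : (Fin n → ℝ) → ℝ) : Prop :=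
  Integrable f ∧ ∀ B : Set (Fin n → ℝ), MeasurableSet B → P.real (X ⁻¹' B) = ∫ x in B, f x

/-- `(Y_r)_{r ∈ [0,τ]}` is a process on the probability space `(Ω, P)` whose vectors
`(Y_{t_0}, …, Y_{t_{n+1}})`, for all `n ≥ 0` and `0 = t_0 < t_1 < … < t_{n+1} = τ`, have the density
`jointDensityY`. (The product form of these densities makes it a Markov process.) -/
structure IsProcessY (a c τ : ℝ) {Ω : Type*} [MeasurableSpace Ω] (P : Measure Ω)
    (Y : ℝ → Ω → ℝ) : Prop where
  isProb : IsProbabilityMeasure P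
  measurable : ∀ r ∈ Icc 0 τ, Measurable (Y r)
  fdd : ∀ (n : ℕ) (t : Fin (n + 2) → ℝ), StrictMono t → t 0 = 0 → t (Fin.last (n + 1)) = τ →
    HasDensity P (fun ω k => Y (t k) ω) (jointDensityY a c τ t)

/-- The transition density from `x` at time `s` to `y` at time `t` (`s < t < c`, `x > 0`) of the
continuous dual Hahn process with state space `(0,∞)`. -/
def transDensity (c s t x y : ℝ) : ℝ :=
  if 0 < y then
    gammaSq ((c - t) / 2) (√y / 2) * gammaSq ((t - s) / 2) ((√x + √y) / 2) *
        gammaSq ((t - s) / 2) ((√x - √y) / 2) /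
      (8 * Real.pi * √y * Real.Gamma (t - s) * (gammaSq ((c - s) / 2) (√x / 2) * gammaSq 0 √y))
  else 0

/-- For times `s_1 > … > s_{n+1}` (listed as `s 0, …, s n`), the density at `(y_1, …, y_n)` of
`(T_{s_1}, …, T_{s_n})` for the Markov process that starts at time `s_{n+1}` from `x`, that is
`∏_{k=1}^n 𝔭_{s_{k+1},s_k}(y_{k+1}, y_k)` with `y_{n+1} = x`. -/
def pathDensityT (c : ℝ) {n : ℕ} (s : Fin (n + 1) → ℝ) (x : ℝ) (y : Fin n → ℝ) : ℝ :=
  ∏ k : Fin n, transDensity c (s k.succ) (s k.castSucc)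
    (Fin.snoc (α := fun _ => ℝ) y x k.succ) (Fin.snoc (α := fun _ => ℝ) y x k.castSucc)

/-- `(T_r)_{-a < r < c}` together with the probability measures
`Q r x = ℙ(· ∣ T_r = x)`, `-a < r < c`, `x > 0`, is the Markov process on `(0,∞)` with transition
densities `transDensity`: under `Q r x` it is at `x` at time `r`, and at the later times it
evolves by these transition probabilities. -/
structure IsProcessT (a c : ℝ) {Ω : Type*} [MeasurableSpace Ω] (Q : ℝ → ℝ → Measure Ω)
    (T : ℝ → Ω → ℝ) : Prop where
  isProb : ∀ r ∈ Ioo (-a) c, ∀ x : ℝ, 0 < x → IsProbabilityMeasure (Q r x)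
  measurable : ∀ r ∈ Ioo (-a) c, Measurable (T r)
  start : ∀ r ∈ Ioo (-a) c, ∀ x : ℝ, 0 < x → ∀ᵐ ω ∂(Q r x), T r ω = x
  fdd : ∀ (n : ℕ) (s : Fin (n + 1) → ℝ), StrictAnti s → (∀ k, s k ∈ Ioo (-a) c) →
    ∀ x : ℝ, 0 < x →
      HasDensity (Q (s (Fin.last n)) x) (fun ω (k : Fin n) => T (s k.castSucc) ω)
        (pathDensityT c s x)

/-- The weight `𝔭̃_s(x)`, for `-a < s < c` and `x > 0`. -/
def weightT (a c τ s x : ℝ) : ℝ :=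
  (2 : ℝ) ^ (a + c) / (16 * Real.pi * normConst a c τ) *
    (gammaSq ((a + s) / 2) (√x / 2) * gammaSq ((c - s) / 2) (√x / 2) / (√x * gammaSq 0 √x))

end DualRep

end

/-!
Both sides of the duality are iterated integrals of one and the same function of `d + 1` positive
spectral variables `v_k = u_k²`.

On the side of `Y`, summation by parts turns the exponent into `∑ σ_j x_j` with the positive
coefficients `c - s_1`, `s_k - s_{k+1}`, `a + s_{d+1}` (`siteExponent`). Inserting the spectral
representation of every heat kernel gives an absolutely convergent integral over all positions
`x_j` and all spectral variables, because `|K_{iu}| ≤ K_0` and because the spectral density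
`sinh (π √v) / π²` is integrable against `exp (-t v)` (`integrable_chain`). By Fubini's theorem the
positions may be integrated first; they separate. The two outer positions contribute the Mellin
transform of `K_{iu}` and the inner ones that of `K_{iu} K_{iv}`, both of which are products of
Gamma functions (`integral_exp_mul_besselK`, `integral_exp_mul_besselK_mul_besselK`).

On the side of `T`, every transition density is the spectral density times such a Mellin transform
times a ratio that telescopes along the path (`transDensity_eq`), so that the path density times
the weight is exactly the integrand found above (`exp_mul_pathDensityT_mul`).

The Mellin transforms themselves come from the change of variables `(p, q) ↦ (p + q, p - q)`. It
turns `Γ(α) Γ(β)`, a double integral in exponential coordinates, into the Mellin transform of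
`K_{iu}`; integrated in the other order, the same double integral gives the Fourier transform of
`cosh ^ (-σ)`. For a product of two Bessel functions the same change of variables decouples the
integral representations, as `cosh (p + q) + cosh (p - q) = 2 cosh p cosh q`, and leaves two of
these Fourier transforms.
-/

namespace DualRep

/-! ### Gamma integrals in exponential coordinates -/

theorem image_exp_univ : Real.exp '' univ = Ioi 0 := by
  rw [image_univ, Real.range_exp]

theorem integral_Ioi_eq_integral_exp {E : Type*} [NormedAddCommGroup E] [NormedSpace ℝ E]
    (g : ℝ → E) : ∫ y in Ioi (0 : ℝ), g y = ∫ x : ℝ, Real.exp x • g (Real.exp x) := by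
  rw [← image_exp_univ, integral_image_eq_integral_abs_deriv_smul MeasurableSet.univ
    (fun x _ => (Real.hasDerivAt_exp x).hasDerivWithinAt) Real.exp_injective.injOn]
  simp

theorem integrableOn_Ioi_iff_integrable_exp {E : Type*} [NormedAddCommGroup E] [NormedSpace ℝ E]
    (g : ℝ → E) :
    IntegrableOn g (Ioi (0 : ℝ)) ↔ Integrable fun x : ℝ => Real.exp x • g (Real.exp x) := by
  rw [← image_exp_univ, integrableOn_image_iff_integrableOn_abs_deriv_smul MeasurableSet.univ
    (fun x _ => (Real.hasDerivAt_exp x).hasDerivWithinAt) Real.exp_injective.injOn]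
  simp

theorem exp_smul_Gamma_integrand (z : ℂ) (x : ℝ) :
    Real.exp x • (((Real.exp (-Real.exp x) : ℝ) : ℂ) * ((Real.exp x : ℝ) : ℂ) ^ (z - 1)) =
      Complex.exp (z * x) * (Real.exp (-Real.exp x) : ℝ) := by
  have h : ((Real.exp x : ℝ) : ℂ) ^ (z - 1) = Complex.exp (x * (z - 1)) := by
    rw [Complex.cpow_def_of_ne_zero (by exact_mod_cast (Real.exp_pos x).ne'), ← Complex.ofReal_log
      (Real.exp_pos x).le, Real.log_exp]
  rw [h, Complex.real_smul, Complex.ofReal_exp x, mul_comm (((Real.exp (-Real.exp x) : ℝ) : ℂ)),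
    ← mul_assoc, ← Complex.exp_add]
  ring_nf

theorem integrable_exp_mul_exp_neg_exp {z : ℂ} (hz : 0 < z.re) :
    Integrable fun x : ℝ => Complex.exp (z * x) * (Real.exp (-Real.exp x) : ℝ) := by
  have h := Complex.GammaIntegral_convergent hz
  rw [integrableOn_Ioi_iff_integrable_exp] at h
  simpa only [exp_smul_Gamma_integrand] using h

theorem integral_exp_mul_exp_neg_exp {z : ℂ} (hz : 0 < z.re) :
    ∫ x : ℝ, Complex.exp (z * x) * (Real.exp (-Real.exp x) : ℝ) = Complex.Gamma z := by
  rw [Complex.Gamma_eq_integral hz, Complex.GammaIntegral, integral_Ioi_eq_integral_exp]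
  exact integral_congr_ae (ae_of_all _ fun x => (exp_smul_Gamma_integrand z x).symm)

theorem integral_exp_mul_exp_neg_mul_exp {σ r : ℝ} (hσ : 0 < σ) (hr : 0 < r) :
    ∫ x : ℝ, Real.exp (σ * x) * Real.exp (-(r * Real.exp x)) = r ^ (-σ) * Real.Gamma σ := by
  have h := Real.integral_rpow_mul_exp_neg_mul_Ioi hσ hr
  rw [one_div, Real.inv_rpow hr.le, ← Real.rpow_neg hr.le, integral_Ioi_eq_integral_exp] at h
  rw [← h]
  refine integral_congr_ae (ae_of_all _ fun x => ?_)
  simp only [smul_eq_mul]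
  simp only [← Real.exp_mul, ← Real.exp_add]
  congr 1
  ring

theorem integrable_exp_mul_exp_neg_mul_exp {σ r : ℝ} (hσ : 0 < σ) (hr : 0 < r) :
    Integrable fun x : ℝ => Real.exp (σ * x) * Real.exp (-(r * Real.exp x)) := by
  by_contra h
  have h1 := integral_exp_mul_exp_neg_mul_exp hσ hr
  rw [integral_undef h] at h1
  exact (mul_pos (Real.rpow_pos_of_pos hr _) (Real.Gamma_pos_of_pos hσ)).ne h1

/-! ### The change of variables `(p, q) ↦ (p + q, p - q)` -/

/-- The linear automorphism `(p, q) ↦ (p + q, p - q)` of the plane. -/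
noncomputable def sumDiff : (ℝ × ℝ) ≃L[ℝ] (ℝ × ℝ) :=
  LinearEquiv.toContinuousLinearEquiv
    { toFun := fun x => (x.1 + x.2, x.1 - x.2)
      invFun := fun x => ((x.1 + x.2) / 2, (x.1 - x.2) / 2)
      map_add' := fun x y => by ext <;> simp <;> ring
      map_smul' := fun r x => by ext <;> simp [mul_add, mul_sub]
      left_inv := fun x => by ext <;> simp
      right_inv := fun x => by ext <;> simp <;> ring }

theorem sumDiff_apply (x : ℝ × ℝ) : sumDiff x = (x.1 + x.2, x.1 - x.2) := rfl

theorem det_sumDiff : LinearMap.det (sumDiff : (ℝ × ℝ) →ₗ[ℝ] (ℝ × ℝ)) = -2 := by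
  rw [← LinearMap.det_toMatrix (Module.Basis.finTwoProd ℝ), Matrix.det_fin_two]
  simp [LinearMap.toMatrix_apply, sumDiff_apply]
  norm_num

theorem map_sumDiff :
    Measure.map sumDiff (volume : Measure (ℝ × ℝ)) = ENNReal.ofReal 2⁻¹ • volume := by
  have h := Measure.map_linearMap_addHaar_eq_smul_addHaar (volume : Measure (ℝ × ℝ))
    (f := (sumDiff : (ℝ × ℝ) →ₗ[ℝ] (ℝ × ℝ))) (by rw [det_sumDiff]; norm_num)
  rw [det_sumDiff] at h
  have h2 : |(-2 : ℝ)⁻¹| = 2⁻¹ := by rw [abs_inv]; norm_num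
  rw [h2] at h
  exact h

theorem integrable_comp_sumDiff {E : Type*} [NormedAddCommGroup E] {F : ℝ × ℝ → E} :
    (Integrable fun x : ℝ × ℝ => F (x.1 + x.2, x.1 - x.2)) ↔ Integrable F := by
  have h := integrable_map_equiv sumDiff.toHomeomorph.toMeasurableEquiv F
    (μ := (volume : Measure (ℝ × ℝ)))
  have h2 : Measure.map sumDiff.toHomeomorph.toMeasurableEquiv (volume : Measure (ℝ × ℝ)) =
    ENNReal.ofReal 2⁻¹ • volume := map_sumDiff
  rw [h2, integrable_smul_measure (by simp) (by simp)] at h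
  exact h.symm

theorem integral_comp_sumDiff {E : Type*} [NormedAddCommGroup E] [NormedSpace ℝ E]
    (F : ℝ × ℝ → E) :
    ∫ x : ℝ × ℝ, F x = (2 : ℝ) • ∫ x : ℝ × ℝ, F (x.1 + x.2, x.1 - x.2) := by
  have h := integral_map_equiv sumDiff.toHomeomorph.toMeasurableEquiv F
    (μ := (volume : Measure (ℝ × ℝ)))
  have h2 : Measure.map sumDiff.toHomeomorph.toMeasurableEquiv (volume : Measure (ℝ × ℝ)) =
    ENNReal.ofReal 2⁻¹ • volume := map_sumDiff
  rw [h2, integral_smul_measure, ENNReal.toReal_ofReal (by norm_num)] at h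
  have h3 : ∫ x : ℝ × ℝ, F (x.1 + x.2, x.1 - x.2) = (2 : ℝ)⁻¹ • ∫ x : ℝ × ℝ, F x := h.symm
  rw [h3, smul_smul]
  norm_num

/-! ### The Mellin transform of one Bessel function -/

theorem gammaSq_eq (p q : ℝ) : ((gammaSq p q : ℝ) : ℂ) =
    Complex.Gamma ((p : ℂ) + Complex.I * q) * Complex.Gamma ((p : ℂ) - Complex.I * q) := by
  have h : ((p : ℂ) - Complex.I * q) = (starRingEnd ℂ) ((p : ℂ) + Complex.I * q) := by
    simp [sub_eq_add_neg]
  rw [h, Complex.Gamma_conj, Complex.mul_conj, Complex.normSq_eq_norm_sq, gammaSq]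

/-- The double integral is `Γ(α) Γ(β)`, with `α, β = (σ ± iu) / 2`, each Gamma function being an
integral over the line, rewritten in sum and difference coordinates. -/
theorem integrable_and_integral_mellin_kernel {σ : ℝ} (hσ : 0 < σ) (u : ℝ) :
    Integrable (fun x : ℝ × ℝ => Complex.exp (σ * x.1 + Complex.I * u * x.2) *
      (Real.exp (-(Real.exp x.1 * Real.cosh x.2)) : ℝ)) ∧
    ∫ x : ℝ × ℝ, Complex.exp (σ * x.1 + Complex.I * u * x.2) *
      (Real.exp (-(Real.exp x.1 * Real.cosh x.2)) : ℝ) =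
        ((2 ^ (σ - 1) * gammaSq (σ / 2) (u / 2) : ℝ) : ℂ) := by
  set α : ℂ := ((σ / 2 : ℝ) : ℂ) + Complex.I * (u / 2 : ℝ) with hα
  set β : ℂ := ((σ / 2 : ℝ) : ℂ) - Complex.I * (u / 2 : ℝ) with hβ
  have hαr : 0 < α.re := by simp [hα]; positivity
  have hβr : 0 < β.re := by simp [hβ]; positivity
  set F : ℝ × ℝ → ℂ := fun x =>
    (Complex.exp (α * x.1) * (Real.exp (-Real.exp x.1) : ℝ)) *
      (Complex.exp (β * x.2) * (Real.exp (-Real.exp x.2) : ℝ)) with hF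
  set G : ℝ × ℝ → ℂ := fun x => Complex.exp (σ * x.1 + Complex.I * u * x.2) *
      (Real.exp (-(Real.exp x.1 * Real.cosh x.2)) : ℝ) with hG
  have hFi : Integrable F :=
    (integrable_exp_mul_exp_neg_exp hαr).mul_prod (integrable_exp_mul_exp_neg_exp hβr)
  have hFint : ∫ x, F x = gammaSq (σ / 2) (u / 2) := by
    rw [gammaSq_eq, ← integral_exp_mul_exp_neg_exp hαr, ← integral_exp_mul_exp_neg_exp hβr]
    exact integral_prod_mul (μ := volume) (ν := volume)
      (fun s : ℝ => Complex.exp (α * s) * (Real.exp (-Real.exp s) : ℝ))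
      (fun s : ℝ => Complex.exp (β * s) * (Real.exp (-Real.exp s) : ℝ))
  -- `e^(m + w) + e^(m - w) = 2 e^m cosh w`, and the shift of `m` by `log 2` absorbs the factor `2`
  have hFG : ∀ x : ℝ × ℝ, F ((x - (Real.log 2, 0)).1 + (x - (Real.log 2, 0)).2,
      (x - (Real.log 2, 0)).1 - (x - (Real.log 2, 0)).2) = ((2 ^ (-σ) : ℝ) : ℂ) * G x := by
    intro x
    have e1 : Real.exp (x.1 - Real.log 2 + x.2) + Real.exp (x.1 - Real.log 2 - x.2) =
        Real.exp x.1 * Real.cosh x.2 := by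
      rw [Real.cosh_eq, Real.exp_add, Real.exp_sub, Real.exp_sub, Real.exp_sub,
        Real.exp_log (by norm_num), Real.exp_neg]
      field_simp
    have e2 : ((2 ^ (-σ) : ℝ) : ℂ) = Complex.exp (-(σ * (Real.log 2 : ℝ))) := by
      rw [Real.rpow_def_of_pos (by norm_num), Complex.ofReal_exp]
      push_cast
      ring_nf
    simp only [hF, hG, Prod.fst_sub, Prod.snd_sub, sub_zero, e2]
    rw [mul_mul_mul_comm, ← Complex.exp_add, ← mul_assoc (Complex.exp (-_)), ← Complex.exp_add,
      ← Complex.ofReal_mul, ← Real.exp_add, ← neg_add, e1]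
    congr 2
    simp only [hα, hβ]
    push_cast
    ring
  have hpos : (0 : ℝ) < 2 ^ (-σ) := Real.rpow_pos_of_pos (by norm_num) _
  have hne : ((2 ^ (-σ) : ℝ) : ℂ) ≠ 0 := by exact_mod_cast hpos.ne'
  constructor
  · have h1 := (integrable_comp_sumDiff.2 hFi).comp_sub_right ((Real.log 2, 0) : ℝ × ℝ)
    have h2 : Integrable fun x => ((2 ^ (-σ) : ℝ) : ℂ) * G x :=
      h1.congr (ae_of_all _ hFG)
    exact (integrable_const_mul_iff (IsUnit.mk0 _ hne) G).1 h2
  · have h1 := integral_comp_sumDiff F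
    rw [← integral_sub_right_eq_self (fun x : ℝ × ℝ => F (x.1 + x.2, x.1 - x.2))
      ((Real.log 2, 0) : ℝ × ℝ), integral_congr_ae (ae_of_all _ hFG), integral_const_mul,
      hFint, Complex.real_smul] at h1
    have h3 : (2 ^ (σ - 1) : ℝ) * (2 * 2 ^ (-σ)) = 1 := by
      nth_rw 2 [← Real.rpow_one 2]
      rw [← Real.rpow_add (by norm_num), ← Real.rpow_add (by norm_num)]
      ring_nf
      simp
    have h4 : ((2 ^ (σ - 1) : ℝ) : ℂ) * (((2 : ℝ) : ℂ) * ((2 ^ (-σ) : ℝ) : ℂ)) = 1 := by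
      exact_mod_cast h3
    rw [Complex.ofReal_mul, h1]
    linear_combination (-(∫ x, G x)) * h4

theorem norm_cexp_add_I_mul (a u w : ℝ) :
    ‖Complex.exp (a + Complex.I * u * w)‖ = Real.exp a := by
  rw [Complex.norm_exp]; simp

theorem norm_cexp_I_mul (u w : ℝ) : ‖Complex.exp (Complex.I * u * w)‖ = 1 := by
  simpa using norm_cexp_add_I_mul 0 u w

theorem integrable_exp_I_mul_cosh_rpow {σ : ℝ} (hσ : 0 < σ) (u : ℝ) :
    Integrable fun w : ℝ => Complex.exp (Complex.I * u * w) * ((Real.cosh w ^ (-σ) : ℝ) : ℂ) := by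
  have h := (integrable_and_integral_mellin_kernel hσ 0).1
  have h2 := ((integrable_prod_iff' h.aestronglyMeasurable).1 h).2
  have h3 : Integrable fun w : ℝ => Real.cosh w ^ (-σ) * Real.Gamma σ := by
    refine h2.congr (ae_of_all _ fun w => ?_)
    dsimp only
    rw [← integral_exp_mul_exp_neg_mul_exp hσ (Real.cosh_pos w)]
    refine integral_congr_ae (ae_of_all _ fun x => ?_)
    simp only [norm_mul, Complex.norm_real, Real.norm_eq_abs, Real.abs_exp]
    rw [← Complex.ofReal_mul, norm_cexp_add_I_mul, mul_comm (Real.exp x)]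
  have h4 := (integrable_mul_const_iff (IsUnit.mk0 _ (Real.Gamma_pos_of_pos hσ).ne') _).1 h3
  refine h4.mono' ?_ (ae_of_all _ fun w => ?_)
  · refine AEStronglyMeasurable.mul (Continuous.aestronglyMeasurable (by fun_prop)) ?_
    exact Complex.continuous_ofReal.comp_aestronglyMeasurable h4.aestronglyMeasurable
  · rw [norm_mul, norm_cexp_I_mul, one_mul, Complex.norm_real, Real.norm_of_nonneg]
    exact Real.rpow_nonneg (Real.cosh_pos w).le _

/-- Integrating the double integral over the position `x` first gives the Fourier transform of
`cosh ^ (-σ)`. -/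
theorem integral_exp_I_mul_cosh_rpow {σ : ℝ} (hσ : 0 < σ) (u : ℝ) :
    ∫ w : ℝ, Complex.exp (Complex.I * u * w) * ((Real.cosh w ^ (-σ) : ℝ) : ℂ) =
      ((2 ^ (σ - 1) * gammaSq (σ / 2) (u / 2) / Real.Gamma σ : ℝ) : ℂ) := by
  obtain ⟨h1, h2⟩ := integrable_and_integral_mellin_kernel hσ u
  rw [Measure.volume_eq_prod, integral_prod_symm _ h1] at h2
  have h3 : ∀ w : ℝ, ∫ x : ℝ, Complex.exp (σ * x + Complex.I * u * w) *
      (Real.exp (-(Real.exp x * Real.cosh w)) : ℝ) =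
      (Complex.exp (Complex.I * u * w) * ((Real.cosh w ^ (-σ) : ℝ) : ℂ)) * Real.Gamma σ := by
    intro w
    rw [mul_assoc (Complex.exp _), ← Complex.ofReal_mul (Real.cosh w ^ (-σ)),
      ← integral_exp_mul_exp_neg_mul_exp hσ (Real.cosh_pos w),
      ← integral_complex_ofReal, ← integral_const_mul]
    refine integral_congr_ae (ae_of_all _ fun x => ?_)
    simp only [Complex.exp_add]
    push_cast
    rw [mul_comm (Complex.cosh _)]
    ring
  simp only [h3] at h2
  rw [integral_mul_const] at h2
  rw [Complex.ofReal_div, ← h2, mul_div_cancel_right₀]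
  exact_mod_cast (Real.Gamma_pos_of_pos hσ).ne'

theorem integrable_exp_I_mul_exp_neg_cosh (u : ℝ) {z : ℝ} (hz : 0 < z) :
    Integrable fun w : ℝ => Complex.exp (Complex.I * u * w) *
      (Real.exp (-(z * Real.cosh w)) : ℝ) := by
  -- `exp (-(z cosh w)) ≤ (z cosh w)⁻¹`
  have h := (integrable_exp_I_mul_cosh_rpow one_pos 0).norm.const_mul z⁻¹
  refine h.mono' (Continuous.aestronglyMeasurable (by fun_prop)) (ae_of_all _ fun w => ?_)
  rw [norm_mul, norm_mul, norm_cexp_I_mul, norm_cexp_I_mul, one_mul, one_mul, Complex.norm_real,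
    Complex.norm_real, Real.norm_of_nonneg (Real.exp_pos _).le, Real.norm_of_nonneg
    (Real.rpow_nonneg (Real.cosh_pos w).le _), Real.rpow_neg_one, ← mul_inv, Real.exp_neg]
  have hp : 0 < z * Real.cosh w := mul_pos hz (Real.cosh_pos w)
  exact inv_anti₀ hp (by linarith [Real.add_one_le_exp (z * Real.cosh w)])

/-- `besselK` as an exponential integral over the whole line; the odd imaginary part vanishes. -/
theorem integral_exp_I_mul_exp_neg_cosh (u : ℝ) {z : ℝ} (hz : 0 < z) :
    ∫ w : ℝ, Complex.exp (Complex.I * u * w) * (Real.exp (-(z * Real.cosh w)) : ℝ) =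
      ((2 * besselK u z : ℝ) : ℂ) := by
  have hi := integrable_exp_I_mul_exp_neg_cosh u hz
  have hre : ∀ w : ℝ, (Complex.exp (Complex.I * u * w) *
      (Real.exp (-(z * Real.cosh w)) : ℝ)).re =
      Real.exp (-(z * Real.cosh |w|)) * Real.cos (u * |w|) := by
    intro w
    have hc : Real.cos (u * |w|) = Real.cos (u * w) := by
      rw [← Real.cos_abs, abs_mul, abs_abs, ← abs_mul, Real.cos_abs]
    rw [Complex.re_mul_ofReal, Real.cosh_abs, hc, mul_comm]
    congr 1
    rw [mul_assoc, mul_comm, ← Complex.ofReal_mul, Complex.exp_ofReal_mul_I_re]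
  have him : ∀ w : ℝ, (Complex.exp (Complex.I * u * w) *
      (Real.exp (-(z * Real.cosh w)) : ℝ)).im =
      Real.exp (-(z * Real.cosh w)) * Real.sin (u * w) := by
    intro w
    rw [Complex.im_mul_ofReal, mul_comm]
    congr 1
    rw [mul_assoc, mul_comm, ← Complex.ofReal_mul, Complex.exp_ofReal_mul_I_im]
  apply Complex.ext
  · have h1 : (∫ w : ℝ, Complex.exp (Complex.I * u * w) *
        (Real.exp (-(z * Real.cosh w)) : ℝ)).re = _ := (integral_re hi).symm
    rw [h1, Complex.ofReal_re, besselK, ← integral_comp_abs]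
    exact integral_congr_ae (ae_of_all _ hre)
  · have h1 : (∫ w : ℝ, Complex.exp (Complex.I * u * w) *
        (Real.exp (-(z * Real.cosh w)) : ℝ)).im = _ := (integral_im hi).symm
    rw [h1, Complex.ofReal_im]
    have h2 : ∫ w : ℝ, Real.exp (-(z * Real.cosh w)) * Real.sin (u * w) = 0 := by
      have h3 := integral_neg_eq_self
        (fun w : ℝ => Real.exp (-(z * Real.cosh w)) * Real.sin (u * w)) volume
      simp only [Real.cosh_neg, mul_neg, Real.sin_neg] at h3
      rw [integral_neg] at h3
      linarith
    rw [← h2]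
    exact integral_congr_ae (ae_of_all _ him)

theorem abs_besselK_le (u : ℝ) {z : ℝ} (hz : 0 < z) : |besselK u z| ≤ besselK 0 z := by
  have h1 := norm_integral_le_integral_norm (μ := volume)
    (fun w : ℝ => Complex.exp (Complex.I * u * w) * (Real.exp (-(z * Real.cosh w)) : ℝ))
  rw [integral_exp_I_mul_exp_neg_cosh u hz, Complex.norm_real, Real.norm_eq_abs, abs_mul] at h1
  have h2 : ∫ w : ℝ, ‖Complex.exp (Complex.I * u * w) * (Real.exp (-(z * Real.cosh w)) : ℝ)‖ =
      2 * besselK 0 z := by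
    have h3 := integral_exp_I_mul_exp_neg_cosh 0 hz
    simp only [Complex.ofReal_zero, mul_zero, zero_mul, Complex.exp_zero, one_mul] at h3
    rw [integral_complex_ofReal] at h3
    rw [← Complex.ofReal_inj.1 h3]
    refine integral_congr_ae (ae_of_all _ fun w => ?_)
    simp only [norm_mul, norm_cexp_I_mul, one_mul, Complex.norm_real, Real.norm_eq_abs,
      Real.abs_exp]
  rw [h2] at h1
  simp at h1
  exact h1

theorem besselK_zero_nonneg (z : ℝ) (hz : 0 < z) : 0 ≤ besselK 0 z :=
  (abs_nonneg _).trans (abs_besselK_le 0 hz)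

theorem integrable_exp_mul_besselK {σ : ℝ} (hσ : 0 < σ) (u : ℝ) :
    Integrable fun x : ℝ => Real.exp (σ * x) * besselK u (Real.exp x) := by
  have h := (integrable_and_integral_mellin_kernel hσ u).1.integral_prod_left
  have h2 : Integrable fun x : ℝ => (((Real.exp (σ * x) * besselK u (Real.exp x) : ℝ)) : ℂ) := by
    refine (h.const_mul (2⁻¹ : ℂ)).congr (ae_of_all _ fun x => ?_)
    simp only [Complex.exp_add, mul_assoc]
    rw [integral_const_mul]
    simp only [← mul_assoc]
    rw [integral_exp_I_mul_exp_neg_cosh u (Real.exp_pos x)]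
    push_cast
    ring
  simpa only [RCLike.re_eq_complex_re, Complex.ofReal_re] using h2.re

/-- The Mellin transform of `K_{iu}`, in exponential coordinates. -/
theorem integral_exp_mul_besselK {σ : ℝ} (hσ : 0 < σ) (u : ℝ) :
    ∫ x : ℝ, Real.exp (σ * x) * besselK u (Real.exp x) =
      2 ^ (σ - 2) * gammaSq (σ / 2) (u / 2) := by
  obtain ⟨h1, h2⟩ := integrable_and_integral_mellin_kernel hσ u
  rw [Measure.volume_eq_prod, integral_prod _ h1] at h2
  have h3 : ∀ x : ℝ, ∫ w : ℝ, Complex.exp (σ * x + Complex.I * u * w) *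
      (Real.exp (-(Real.exp x * Real.cosh w)) : ℝ) =
      ((2 * (Real.exp (σ * x) * besselK u (Real.exp x)) : ℝ) : ℂ) := by
    intro x
    simp only [Complex.exp_add, mul_assoc]
    rw [integral_const_mul]
    simp only [← mul_assoc]
    rw [integral_exp_I_mul_exp_neg_cosh u (Real.exp_pos x)]
    push_cast
    ring
  simp only [h3] at h2
  rw [integral_complex_ofReal, Complex.ofReal_inj, integral_const_mul] at h2
  have h4 : (2 : ℝ) ^ (σ - 1) = 2 * 2 ^ (σ - 2) := by
    nth_rw 2 [← Real.rpow_one 2]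
    rw [← Real.rpow_add (by norm_num)]
    ring_nf
  rw [h4] at h2
  linarith

/-! ### The Mellin transform of a product of two Bessel functions -/

/-- Integrating the norm over the position first leaves a multiple of
`(cosh p) ^ (-σ) * (cosh q) ^ (-σ)`. -/
theorem integrable_mellin_kernel_two {σ : ℝ} (hσ : 0 < σ) (u v : ℝ) :
    Integrable (fun x : ℝ × (ℝ × ℝ) => Complex.exp (σ * x.1) *
      (Complex.exp (Complex.I * u * x.2.1) * Complex.exp (Complex.I * v * x.2.2)) *
      (Real.exp (-(2 * Real.cosh x.2.1 * Real.cosh x.2.2 * Real.exp x.1)) : ℝ)) := by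
  have hm : AEStronglyMeasurable (fun x : ℝ × (ℝ × ℝ) => Complex.exp (σ * x.1) *
      (Complex.exp (Complex.I * u * x.2.1) * Complex.exp (Complex.I * v * x.2.2)) *
      (Real.exp (-(2 * Real.cosh x.2.1 * Real.cosh x.2.2 * Real.exp x.1)) : ℝ))
      ((volume : Measure ℝ).prod (volume : Measure (ℝ × ℝ))) :=
    Continuous.aestronglyMeasurable (by fun_prop)
  have hpos : ∀ y : ℝ × ℝ, 0 < 2 * Real.cosh y.1 * Real.cosh y.2 := fun y =>
    mul_pos (mul_pos two_pos (Real.cosh_pos _)) (Real.cosh_pos _)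
  have hnorm : ∀ (x : ℝ) (y : ℝ × ℝ), ‖Complex.exp (σ * x) *
      (Complex.exp (Complex.I * u * y.1) * Complex.exp (Complex.I * v * y.2)) *
      (Real.exp (-(2 * Real.cosh y.1 * Real.cosh y.2 * Real.exp x)) : ℝ)‖ =
      Real.exp (σ * x) * Real.exp (-(2 * Real.cosh y.1 * Real.cosh y.2 * Real.exp x)) := by
    intro x y
    rw [norm_mul, norm_mul, norm_mul, norm_cexp_I_mul, norm_cexp_I_mul, Complex.norm_real,
      Real.norm_of_nonneg (Real.exp_pos _).le, ← Complex.ofReal_mul, Complex.norm_exp_ofReal]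
    ring
  refine (integrable_prod_iff' hm).2 ⟨ae_of_all _ fun y => ?_, ?_⟩
  · refine (integrable_exp_mul_exp_neg_mul_exp hσ (hpos y)).mono'
      (Continuous.aestronglyMeasurable (by fun_prop)) (ae_of_all _ fun x => ?_)
    exact (hnorm x y).le
  · have h1 := (integrable_exp_I_mul_cosh_rpow hσ 0).norm
    have h2 := (h1.mul_prod h1).const_mul (2 ^ (-σ) * Real.Gamma σ)
    refine h2.congr (ae_of_all _ fun y => ?_)
    simp only [hnorm]
    rw [integral_exp_mul_exp_neg_mul_exp hσ (hpos y),
      Real.mul_rpow (mul_pos two_pos (Real.cosh_pos _)).le (Real.cosh_pos _).le,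
      Real.mul_rpow two_pos.le (Real.cosh_pos _).le, norm_mul, norm_mul, norm_cexp_I_mul,
      norm_cexp_I_mul, Complex.norm_real, Complex.norm_real,
      Real.norm_of_nonneg (Real.rpow_nonneg (Real.cosh_pos _).le _),
      Real.norm_of_nonneg (Real.rpow_nonneg (Real.cosh_pos _).le _)]
    ring

theorem integral_mellin_kernel_two {σ : ℝ} (hσ : 0 < σ) (u v : ℝ) :
    ∫ x : ℝ × (ℝ × ℝ), Complex.exp (σ * x.1) *
      (Complex.exp (Complex.I * u * x.2.1) * Complex.exp (Complex.I * v * x.2.2)) *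
      (Real.exp (-(2 * Real.cosh x.2.1 * Real.cosh x.2.2 * Real.exp x.1)) : ℝ) =
    ((2 ^ (σ - 2) / Real.Gamma σ * gammaSq (σ / 2) (u / 2) * gammaSq (σ / 2) (v / 2) : ℝ) : ℂ) := by
  rw [Measure.volume_eq_prod, integral_prod_symm _ (integrable_mellin_kernel_two hσ u v)]
  have hpos : ∀ y : ℝ × ℝ, 0 < 2 * Real.cosh y.1 * Real.cosh y.2 := fun y =>
    mul_pos (mul_pos two_pos (Real.cosh_pos _)) (Real.cosh_pos _)
  have h3 : ∀ y : ℝ × ℝ, ∫ x : ℝ, Complex.exp (σ * x) *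
      (Complex.exp (Complex.I * u * y.1) * Complex.exp (Complex.I * v * y.2)) *
      (Real.exp (-(2 * Real.cosh y.1 * Real.cosh y.2 * Real.exp x)) : ℝ) =
      ((2 ^ (-σ) * Real.Gamma σ : ℝ) : ℂ) *
        ((Complex.exp (Complex.I * u * y.1) * ((Real.cosh y.1 ^ (-σ) : ℝ) : ℂ)) *
        (Complex.exp (Complex.I * v * y.2) * ((Real.cosh y.2 ^ (-σ) : ℝ) : ℂ))) := by
    intro y
    have h4 := integral_exp_mul_exp_neg_mul_exp hσ (hpos y)
    rw [Real.mul_rpow (mul_pos two_pos (Real.cosh_pos _)).le (Real.cosh_pos _).le,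
      Real.mul_rpow two_pos.le (Real.cosh_pos _).le] at h4
    have h5 := congrArg (fun r : ℝ => (r : ℂ)) h4
    simp only [← integral_complex_ofReal, Complex.ofReal_mul] at h5
    have h6 : ∀ x : ℝ, Complex.exp (σ * x) *
      (Complex.exp (Complex.I * u * y.1) * Complex.exp (Complex.I * v * y.2)) *
      (Real.exp (-(2 * Real.cosh y.1 * Real.cosh y.2 * Real.exp x)) : ℝ) =
      (Complex.exp (Complex.I * u * y.1) * Complex.exp (Complex.I * v * y.2)) *
      ((Real.exp (σ * x) : ℝ) *
        (Real.exp (-(2 * Real.cosh y.1 * Real.cosh y.2 * Real.exp x)) : ℝ)) := by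
      intro x
      rw [Complex.ofReal_exp (σ * x), Complex.ofReal_mul σ x]
      ring
    simp only [h6]
    rw [integral_const_mul, h5]
    push_cast
    ring
  simp only [h3]
  rw [integral_const_mul, Measure.volume_eq_prod, integral_prod_mul (μ := volume) (ν := volume)
    (fun p : ℝ => Complex.exp (Complex.I * u * p) * ((Real.cosh p ^ (-σ) : ℝ) : ℂ))
    (fun q : ℝ => Complex.exp (Complex.I * v * q) * ((Real.cosh q ^ (-σ) : ℝ) : ℂ)),
    integral_exp_I_mul_cosh_rpow hσ, integral_exp_I_mul_cosh_rpow hσ, ← Complex.ofReal_mul,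
    ← Complex.ofReal_mul, Complex.ofReal_inj]
  have h7 : (2 : ℝ) ^ (σ - 2) = 2 ^ (-σ) * 2 ^ (σ - 1) * 2 ^ (σ - 1) := by
    rw [← Real.rpow_add two_pos, ← Real.rpow_add two_pos]
    ring_nf
  have h8 := (Real.Gamma_pos_of_pos hσ).ne'
  rw [h7]
  field_simp

theorem cosh_sum_add_cosh_diff (p q : ℝ) :
    Real.cosh (p + q) + Real.cosh (p - q) = 2 * Real.cosh p * Real.cosh q := by
  rw [Real.cosh_add, Real.cosh_sub]
  ring

/-- In the coordinates `w = p + q`, `w' = p - q` the integral representations of the two Bessel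
functions decouple, because `cosh w + cosh w' = 2 cosh p cosh q`. -/
theorem besselK_mul_besselK (u v : ℝ) {z : ℝ} (hz : 0 < z) :
    ((2 * (besselK u z * besselK v z) : ℝ) : ℂ) =
    ∫ y : ℝ × ℝ, (Complex.exp (Complex.I * (u + v : ℝ) * y.1) *
      Complex.exp (Complex.I * (u - v : ℝ) * y.2)) *
      (Real.exp (-(2 * Real.cosh y.1 * Real.cosh y.2 * z)) : ℝ) := by
  have h := integral_prod_mul (μ := volume) (ν := volume)
    (fun w : ℝ => Complex.exp (Complex.I * u * w) * (Real.exp (-(z * Real.cosh w)) : ℝ))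
    (fun w : ℝ => Complex.exp (Complex.I * v * w) * (Real.exp (-(z * Real.cosh w)) : ℝ))
  rw [integral_exp_I_mul_exp_neg_cosh u hz, integral_exp_I_mul_exp_neg_cosh v hz,
    ← Measure.volume_eq_prod, integral_comp_sumDiff] at h
  have h2 : ∀ y : ℝ × ℝ, Complex.exp (Complex.I * u * ((y.1 + y.2 : ℝ) : ℂ)) *
      (Real.exp (-(z * Real.cosh (y.1 + y.2))) : ℝ) *
      (Complex.exp (Complex.I * v * ((y.1 - y.2 : ℝ) : ℂ)) *
      (Real.exp (-(z * Real.cosh (y.1 - y.2))) : ℝ)) =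
      (Complex.exp (Complex.I * (u + v : ℝ) * y.1) *
      Complex.exp (Complex.I * (u - v : ℝ) * y.2)) *
      (Real.exp (-(2 * Real.cosh y.1 * Real.cosh y.2 * z)) : ℝ) := by
    intro y
    rw [mul_mul_mul_comm, ← Complex.exp_add, ← Complex.ofReal_mul, ← Real.exp_add, ← neg_add,
      ← mul_add, cosh_sum_add_cosh_diff, ← Complex.exp_add, mul_comm z]
    congr 2
    push_cast
    ring
  simp only [h2] at h
  rw [Complex.real_smul] at h
  have h3 : ((2 : ℝ) : ℂ) ≠ 0 := by norm_num
  apply mul_left_cancel₀ h3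
  rw [h]
  push_cast
  ring

/-- Integrating the triple integrand over `(p, q)` first gives the product of two Bessel
functions. -/
theorem mellin_kernel_two_fiber (σ u v x : ℝ) :
    ∫ y : ℝ × ℝ, Complex.exp (σ * x) *
      (Complex.exp (Complex.I * (u + v : ℝ) * y.1) * Complex.exp (Complex.I * (u - v : ℝ) * y.2)) *
      (Real.exp (-(2 * Real.cosh y.1 * Real.cosh y.2 * Real.exp x)) : ℝ) =
    ((2 * (Real.exp (σ * x) * (besselK u (Real.exp x) * besselK v (Real.exp x))) : ℝ) : ℂ) := by
  simp only [mul_assoc (Complex.exp (σ * x))]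
  rw [integral_const_mul, ← besselK_mul_besselK u v (Real.exp_pos x)]
  push_cast
  ring

theorem integrable_exp_mul_besselK_mul_besselK {σ : ℝ} (hσ : 0 < σ) (u v : ℝ) :
    Integrable fun x : ℝ =>
      Real.exp (σ * x) * (besselK u (Real.exp x) * besselK v (Real.exp x)) := by
  have h := (integrable_mellin_kernel_two hσ (u + v) (u - v)).integral_prod_left
  simp only [mellin_kernel_two_fiber] at h
  have h2 : Integrable fun x : ℝ =>
      2 * (Real.exp (σ * x) * (besselK u (Real.exp x) * besselK v (Real.exp x))) := by
    simpa only [RCLike.re_eq_complex_re, Complex.ofReal_re] using h.re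
  exact (integrable_const_mul_iff (IsUnit.mk0 _ two_ne_zero) _).1 h2

/-- The Mellin transform of `K_{iu} K_{iv}`, in exponential coordinates. -/
theorem integral_exp_mul_besselK_mul_besselK {σ : ℝ} (hσ : 0 < σ) (u v : ℝ) :
    ∫ x : ℝ, Real.exp (σ * x) * (besselK u (Real.exp x) * besselK v (Real.exp x)) =
      2 ^ (σ - 3) / Real.Gamma σ *
        (gammaSq (σ / 2) ((u + v) / 2) * gammaSq (σ / 2) ((u - v) / 2)) := by
  have h := integral_mellin_kernel_two hσ (u + v) (u - v)
  rw [Measure.volume_eq_prod, integral_prod _ (integrable_mellin_kernel_two hσ _ _)] at h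
  simp only [mellin_kernel_two_fiber] at h
  rw [integral_complex_ofReal, Complex.ofReal_inj, integral_const_mul] at h
  have h4 : (2 : ℝ) ^ (σ - 2) = 2 * 2 ^ (σ - 3) := by
    rw [show σ - 2 = 1 + (σ - 3) by ring, Real.rpow_add two_pos, Real.rpow_one]
  rw [h4] at h
  apply mul_left_cancel₀ (two_ne_zero (α := ℝ))
  rw [h]
  ring

/-! ### The spectral density -/

theorem gammaSq_pos {p : ℝ} (hp : 0 < p) (q : ℝ) : 0 < gammaSq p q := by
  have : Complex.Gamma ((p : ℂ) + Complex.I * q) ≠ 0 :=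
    Complex.Gamma_ne_zero_of_re_pos (by simpa using hp)
  exact pow_pos (norm_pos_iff.2 this) 2

/-- Euler's reflection formula on the imaginary axis. -/
theorem gammaSq_zero {u : ℝ} (hu : 0 < u) :
    gammaSq 0 u = Real.pi / (u * Real.sinh (Real.pi * u)) := by
  have h1 := Complex.Gamma_mul_Gamma_one_sub (Complex.I * u)
  have hne : (-(Complex.I * u) : ℂ) ≠ 0 := by
    simpa using hu.ne'
  have h2 : Complex.Gamma (1 - Complex.I * u) =
      -(Complex.I * u) * Complex.Gamma (-(Complex.I * u)) := by
    rw [← Complex.Gamma_add_one _ hne]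
    ring_nf
  have h3 : Complex.sin (Real.pi * (Complex.I * u)) = Real.sinh (Real.pi * u) * Complex.I := by
    rw [Complex.ofReal_sinh, ← Complex.sin_mul_I]
    push_cast
    ring_nf
  have h4 := gammaSq_eq 0 u
  have h5 : 0 < Real.sinh (Real.pi * u) := Real.sinh_pos_iff.2 (by positivity)
  have h5c : (Real.sinh (Real.pi * u) : ℂ) ≠ 0 := by exact_mod_cast h5.ne'
  have huc : (u : ℂ) ≠ 0 := by exact_mod_cast hu.ne'
  rw [h2, h3] at h1
  simp only [Complex.ofReal_zero, zero_add, zero_sub] at h4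
  have h6 : ((gammaSq 0 u : ℝ) : ℂ) = ((Real.pi / (u * Real.sinh (Real.pi * u)) : ℝ) : ℂ) := by
    rw [h4, Complex.ofReal_div, Complex.ofReal_mul, eq_div_iff (mul_ne_zero huc h5c)]
    rw [eq_div_iff (mul_ne_zero h5c Complex.I_ne_zero)] at h1
    linear_combination h1 + (Complex.Gamma (Complex.I * u) * Complex.Gamma (-(Complex.I * u)) * u *
      Real.sinh (Real.pi * u)) * Complex.I_sq
  exact_mod_cast h6

/-- The density `sinh (π √v) / π²` of the measure `(2 / π) |Γ(iu)|⁻² du` in the variable `v = u²`.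
It vanishes for `v ≤ 0`, because `√v = 0` there. -/
noncomputable def specDensity (v : ℝ) : ℝ := Real.sinh (Real.pi * √v) / Real.pi ^ 2

theorem specDensity_of_pos {v : ℝ} (hv : 0 < v) :
    specDensity v = 1 / (Real.pi * √v * gammaSq 0 √v) := by
  have hs : 0 < √v := Real.sqrt_pos.2 hv
  have h5 : 0 < Real.sinh (Real.pi * √v) := Real.sinh_pos_iff.2 (by positivity)
  rw [gammaSq_zero hs, specDensity]
  field_simp

theorem specDensity_of_nonpos {v : ℝ} (hv : v ≤ 0) : specDensity v = 0 := by
  simp [specDensity, Real.sqrt_eq_zero_of_nonpos hv]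

theorem specDensity_nonneg (v : ℝ) : 0 ≤ specDensity v :=
  div_nonneg (Real.sinh_nonneg_iff.2 (by positivity)) (by positivity)

theorem continuous_specDensity : Continuous specDensity := by
  unfold specDensity
  fun_prop

theorem integrable_exp_mul_specDensity {t : ℝ} (ht : 0 < t) :
    Integrable fun v : ℝ => Real.exp (-(t * v)) * specDensity v := by
  have hg : Integrable ((Ioi (0 : ℝ)).indicator fun v : ℝ =>
      Real.exp (Real.pi ^ 2 / (2 * t)) / Real.pi ^ 2 * Real.exp (-(t / 2) * v)) :=
    IntegrableOn.integrable_indicator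
      ((exp_neg_integrableOn_Ioi 0 (by positivity : 0 < t / 2)).const_mul _) measurableSet_Ioi
  refine hg.mono' (Continuous.aestronglyMeasurable ?_) (ae_of_all _ fun v => ?_)
  · have := continuous_specDensity
    fun_prop
  · rw [Real.norm_of_nonneg (mul_nonneg (Real.exp_pos _).le (specDensity_nonneg v))]
    by_cases hv : 0 < v
    · rw [indicator_of_mem (mem_Ioi.2 hv), specDensity]
      have h1 : Real.sinh (Real.pi * √v) ≤ Real.exp (Real.pi * √v) := by
        rw [Real.sinh_eq]
        linarith [Real.exp_pos (Real.pi * √v), Real.exp_pos (-(Real.pi * √v))]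
      -- the arithmetic-geometric mean inequality for `π / √t` and `√t √v`
      have h2 : Real.pi * √v ≤ Real.pi ^ 2 / (2 * t) + t / 2 * v := by
        have h3 : 0 ≤ (Real.pi - t * √v) ^ 2 / (2 * t) := by positivity
        have h4 : (Real.pi - t * √v) ^ 2 / (2 * t) =
            Real.pi ^ 2 / (2 * t) - Real.pi * √v + t / 2 * √v ^ 2 := by
          field_simp
          ring
        rw [h4, Real.sq_sqrt hv.le] at h3
        linarith
      calc Real.exp (-(t * v)) * (Real.sinh (Real.pi * √v) / Real.pi ^ 2)
          ≤ Real.exp (-(t * v)) *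
            (Real.exp (Real.pi ^ 2 / (2 * t) + t / 2 * v) / Real.pi ^ 2) := by
            gcongr
            exact h1.trans (Real.exp_le_exp.2 h2)
        _ = _ := by
            rw [Real.exp_add, show -(t * v) = -(t / 2) * v + -(t / 2 * v) by ring, Real.exp_add,
              Real.exp_neg (t / 2 * v)]
            have := (Real.exp_pos (t / 2 * v)).ne'
            field_simp
    · rw [specDensity_of_nonpos (not_lt.1 hv), indicator_of_notMem (by simpa using hv), mul_zero]

/-- The heat kernel after the substitution `v = u²`. -/
theorem heatKernel_eq (t x y : ℝ) :
    heatKernel t x y = ∫ v : ℝ, Real.exp (-(t * v)) * specDensity v *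
      (besselK √v (Real.exp x) * besselK √v (Real.exp y)) := by
  have h0 : ∫ v : ℝ, Real.exp (-(t * v)) * specDensity v *
      (besselK √v (Real.exp x) * besselK √v (Real.exp y)) =
      ∫ v in Ioi (0 : ℝ), Real.exp (-(t * v)) * specDensity v *
      (besselK √v (Real.exp x) * besselK √v (Real.exp y)) := by
    refine (setIntegral_eq_integral_of_forall_compl_eq_zero fun v hv => ?_).symm
    rw [specDensity_of_nonpos (not_lt.1 hv)]
    ring
  rw [h0, ← integral_comp_rpow_Ioi_of_pos two_pos, heatKernel]
  refine setIntegral_congr_fun measurableSet_Ioi fun u hu => ?_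
  have hu : 0 < u := hu
  have h1 : √(u ^ (2 : ℝ)) = u := by
    rw [Real.rpow_two, Real.sqrt_sq hu.le]
  simp only [smul_eq_mul]
  rw [specDensity_of_pos (Real.rpow_pos_of_pos hu _), h1, Real.rpow_two,
    show (2 : ℝ) - 1 = 1 by norm_num, Real.rpow_one]
  have h5 : 0 < Real.sinh (Real.pi * u) := Real.sinh_pos_iff.2 (by positivity)
  rw [gammaSq_zero hu]
  field_simp

theorem measurable_besselK : Measurable fun p : ℝ × ℝ => besselK p.1 p.2 := by
  have h : StronglyMeasurable (Function.uncurry fun (p : ℝ × ℝ) (w : ℝ) =>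
      Real.exp (-(p.2 * Real.cosh w)) * Real.cos (p.1 * w)) :=
    Continuous.stronglyMeasurable (by fun_prop)
  exact (h.integral_prod_right (ν := volume.restrict (Ioi (0 : ℝ)))).measurable

/-! ### Fubini's theorem for chains of heat kernels -/

variable {d : ℕ}

/-- The factors of the integrand that depend on the `j`-th position: the exponential weight and the
one (`j = 0`, `j = d + 1`) or two Bessel functions coming from the adjacent heat kernels. -/
noncomputable def siteFactor (σ : Fin (d + 2) → ℝ) (v : Fin (d + 1) → ℝ) (j : Fin (d + 2))
    (x : ℝ) : ℝ :=
  Real.exp (σ j * x) *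
    ((Fin.snoc (α := fun _ => ℝ) (fun k => besselK √(v k) (Real.exp x)) 1 j : ℝ) *
      (Fin.cons (α := fun _ => ℝ) 1 (fun k => besselK √(v k) (Real.exp x)) j : ℝ))

/-- The integral of `siteFactor` over the position. -/
noncomputable def siteIntegral (σ : Fin (d + 2) → ℝ) (v : Fin (d + 1) → ℝ) (j : Fin (d + 2)) : ℝ :=
  ∫ x : ℝ, siteFactor σ v j x

theorem siteFactor_zero (σ : Fin (d + 2) → ℝ) (v : Fin (d + 1) → ℝ) (x : ℝ) :
    siteFactor σ v 0 x = Real.exp (σ 0 * x) * besselK √(v 0) (Real.exp x) := by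
  have h : (Fin.snoc (α := fun _ => ℝ) (fun k => besselK √(v k) (Real.exp x)) 1 0 : ℝ) =
      besselK √(v 0) (Real.exp x) := by
    rw [← Fin.castSucc_zero, Fin.snoc_castSucc]
  rw [siteFactor, h, Fin.cons_zero, mul_one]

theorem siteFactor_last (σ : Fin (d + 2) → ℝ) (v : Fin (d + 1) → ℝ) (x : ℝ) :
    siteFactor σ v (Fin.last _) x =
      Real.exp (σ (Fin.last _) * x) * besselK √(v (Fin.last _)) (Real.exp x) := by
  rw [siteFactor, Fin.snoc_last, ← Fin.succ_last, Fin.cons_succ, one_mul]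

theorem siteFactor_mid (σ : Fin (d + 2) → ℝ) (v : Fin (d + 1) → ℝ) (k : Fin d) (x : ℝ) :
    siteFactor σ v k.castSucc.succ x = Real.exp (σ k.castSucc.succ * x) *
      (besselK √(v k.succ) (Real.exp x) * besselK √(v k.castSucc) (Real.exp x)) := by
  rw [siteFactor, Fin.cons_succ, Fin.succ_castSucc, Fin.snoc_castSucc]

/-- The positions `0, …, d + 1` are the first one, the inner ones, and the last one. -/
theorem forall_site {p : Fin (d + 2) → Prop} (h0 : p 0) (hl : p (Fin.last _))
    (hm : ∀ k : Fin d, p k.castSucc.succ) (j : Fin (d + 2)) : p j := by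
  refine Fin.cases h0 (fun k => ?_) j
  refine Fin.lastCases ?_ (fun i => hm i) k
  simpa using hl

theorem integrable_siteFactor {σ : Fin (d + 2) → ℝ} (hσ : ∀ j, 0 < σ j) (v : Fin (d + 1) → ℝ)
    (j : Fin (d + 2)) : Integrable (siteFactor σ v j) := by
  refine forall_site (p := fun j => Integrable (siteFactor σ v j)) ?_ ?_ (fun k => ?_) j
  · simp only [funext (siteFactor_zero σ v)]
    exact integrable_exp_mul_besselK (hσ _) _
  · simp only [funext (siteFactor_last σ v)]
    exact integrable_exp_mul_besselK (hσ _) _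
  · simp only [funext (siteFactor_mid σ v k)]
    exact integrable_exp_mul_besselK_mul_besselK (hσ _) _ _

theorem siteIntegral_zero {σ : Fin (d + 2) → ℝ} (hσ : ∀ j, 0 < σ j) (v : Fin (d + 1) → ℝ) :
    siteIntegral σ v 0 = 2 ^ (σ 0 - 2) * gammaSq (σ 0 / 2) (√(v 0) / 2) := by
  simp only [siteIntegral, siteFactor_zero]
  exact integral_exp_mul_besselK (hσ _) _

theorem siteIntegral_last {σ : Fin (d + 2) → ℝ} (hσ : ∀ j, 0 < σ j) (v : Fin (d + 1) → ℝ) :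
    siteIntegral σ v (Fin.last _) = 2 ^ (σ (Fin.last _) - 2) *
      gammaSq (σ (Fin.last _) / 2) (√(v (Fin.last _)) / 2) := by
  simp only [siteIntegral, siteFactor_last]
  exact integral_exp_mul_besselK (hσ _) _

theorem siteIntegral_mid {σ : Fin (d + 2) → ℝ} (hσ : ∀ j, 0 < σ j) (v : Fin (d + 1) → ℝ)
    (k : Fin d) :
    siteIntegral σ v k.castSucc.succ =
      2 ^ (σ k.castSucc.succ - 3) / Real.Gamma (σ k.castSucc.succ) *
        (gammaSq (σ k.castSucc.succ / 2) ((√(v k.succ) + √(v k.castSucc)) / 2) *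
          gammaSq (σ k.castSucc.succ / 2) ((√(v k.succ) - √(v k.castSucc)) / 2)) := by
  simp only [siteIntegral, siteFactor_mid]
  exact integral_exp_mul_besselK_mul_besselK (hσ _) _ _

theorem abs_siteFactor_le (σ : Fin (d + 2) → ℝ) (v : Fin (d + 1) → ℝ) (j : Fin (d + 2)) (x : ℝ) :
    |siteFactor σ v j x| ≤ siteFactor σ 0 j x := by
  have hx := Real.exp_pos x
  have hK : ∀ k, |besselK √(v k) (Real.exp x)| ≤ besselK 0 (Real.exp x) := fun k =>
    abs_besselK_le _ hx
  refine forall_site (p := fun j => |siteFactor σ v j x| ≤ siteFactor σ 0 j x) ?_ ?_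
    (fun k => ?_) j
  · simp only [siteFactor_zero, Pi.zero_apply, Real.sqrt_zero, abs_mul, Real.abs_exp]
    gcongr
    exact hK _
  · simp only [siteFactor_last, Pi.zero_apply, Real.sqrt_zero, abs_mul, Real.abs_exp]
    gcongr
    exact hK _
  · simp only [siteFactor_mid, Pi.zero_apply, Real.sqrt_zero, abs_mul, Real.abs_exp]
    gcongr
    · exact besselK_zero_nonneg _ hx
    · exact hK _
    · exact hK _

theorem measurable_siteFactor (σ : Fin (d + 2) → ℝ) (j : Fin (d + 2)) :
    Measurable fun p : (Fin (d + 1) → ℝ) × ℝ => siteFactor σ p.1 j p.2 := by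
  have hK : ∀ k, Measurable fun p : (Fin (d + 1) → ℝ) × ℝ => besselK √(p.1 k) (Real.exp p.2) :=
    fun k => measurable_besselK.comp (Measurable.prodMk (by fun_prop) (by fun_prop))
  refine forall_site
    (p := fun j => Measurable fun p : (Fin (d + 1) → ℝ) × ℝ => siteFactor σ p.1 j p.2)
    ?_ ?_ (fun k => ?_) j
  · simp only [siteFactor_zero]
    exact Measurable.mul (by fun_prop) (hK _)
  · simp only [siteFactor_last]
    exact Measurable.mul (by fun_prop) (hK _)
  · simp only [siteFactor_mid]
    exact Measurable.mul (by fun_prop) ((hK _).mul (hK _))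

theorem measurable_siteIntegral (σ : Fin (d + 2) → ℝ) (j : Fin (d + 2)) :
    Measurable fun v => siteIntegral σ v j :=
  ((measurable_siteFactor σ j).stronglyMeasurable.integral_prod_right' (ν := volume)).measurable

theorem abs_siteIntegral_le {σ : Fin (d + 2) → ℝ} (hσ : ∀ j, 0 < σ j) (v : Fin (d + 1) → ℝ)
    (j : Fin (d + 2)) : |siteIntegral σ v j| ≤ siteIntegral σ 0 j :=
  norm_integral_le_of_norm_le (f := siteFactor σ v j) (integrable_siteFactor hσ 0 j)
    (ae_of_all _ fun x => abs_siteFactor_le σ v j x)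

/-- The integrand, in the spectral variables `v k = (u k)²`, to which both sides of the duality
reduce. -/
noncomputable def dualIntegrand (δ : Fin (d + 1) → ℝ) (σ : Fin (d + 2) → ℝ)
    (v : Fin (d + 1) → ℝ) : ℝ :=
  (∏ k, Real.exp (-(δ k * v k)) * specDensity (v k)) * ∏ j, siteIntegral σ v j

theorem measurable_dualIntegrand (δ : Fin (d + 1) → ℝ) (σ : Fin (d + 2) → ℝ) :
    Measurable (dualIntegrand δ σ) := by
  have := continuous_specDensity.measurable
  refine Measurable.mul ?_ (Finset.measurable_prod _ fun j _ => measurable_siteIntegral σ j)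
  fun_prop

theorem abs_dualIntegrand_le {σ : Fin (d + 2) → ℝ} (hσ : ∀ j, 0 < σ j) (δ : Fin (d + 1) → ℝ)
    (v : Fin (d + 1) → ℝ) :
    |dualIntegrand δ σ v| ≤
      (∏ k, Real.exp (-(δ k * v k)) * specDensity (v k)) * ∏ j, siteIntegral σ 0 j := by
  have h0 : 0 ≤ ∏ k, Real.exp (-(δ k * v k)) * specDensity (v k) :=
    Finset.prod_nonneg fun k _ => mul_nonneg (Real.exp_pos _).le (specDensity_nonneg _)
  rw [dualIntegrand, abs_mul, abs_of_nonneg h0, Finset.abs_prod]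
  gcongr with j _
  exact abs_siteIntegral_le hσ v j

/-- The Bessel functions of the `d + 1` heat kernels, sorted by position. -/
theorem prod_siteFactor (σ : Fin (d + 2) → ℝ) (v : Fin (d + 1) → ℝ) (x : Fin (d + 2) → ℝ) :
    ∏ j, siteFactor σ v j (x j) = Real.exp (∑ j, σ j * x j) *
      ∏ k : Fin (d + 1), besselK √(v k) (Real.exp (x k.castSucc)) *
        besselK √(v k) (Real.exp (x k.succ)) := by
  simp only [siteFactor, Finset.prod_mul_distrib, Real.exp_sum]
  congr 2
  · rw [Fin.prod_univ_castSucc]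
    simp
  · rw [Fin.prod_univ_succ]
    simp

/-- The integrand of all positions and all spectral variables is absolutely integrable: the
Bessel functions are dominated by `K_0`, uniformly in the spectral variables. -/
theorem integrable_chain {δ : Fin (d + 1) → ℝ} {σ : Fin (d + 2) → ℝ} (hδ : ∀ k, 0 < δ k)
    (hσ : ∀ j, 0 < σ j) :
    Integrable (fun p : (Fin (d + 2) → ℝ) × (Fin (d + 1) → ℝ) =>
      (∏ j, siteFactor σ p.2 j (p.1 j)) *
        ∏ k, Real.exp (-(δ k * p.2 k)) * specDensity (p.2 k)) := by
  have h1 : Integrable fun x : Fin (d + 2) → ℝ => ∏ j, siteFactor σ 0 j (x j) :=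
    Integrable.fintype_prod fun j => integrable_siteFactor hσ 0 j
  have h2 : Integrable fun v : Fin (d + 1) → ℝ =>
      ∏ k, Real.exp (-(δ k * v k)) * specDensity (v k) :=
    Integrable.fintype_prod (f := fun k v => Real.exp (-(δ k * v)) * specDensity v)
      fun k => integrable_exp_mul_specDensity (hδ k)
  refine (h1.mul_prod h2).mono' (Measurable.aestronglyMeasurable ?_) (ae_of_all _ fun p => ?_)
  · have := continuous_specDensity.measurable
    refine Measurable.mul (Finset.measurable_prod _ fun j _ => ?_) (by fun_prop)
    exact (measurable_siteFactor σ j).comp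
      (f := fun p : (Fin (d + 2) → ℝ) × (Fin (d + 1) → ℝ) => (p.2, p.1 j)) (by fun_prop)
  · have h0 : 0 ≤ ∏ k, Real.exp (-(δ k * p.2 k)) * specDensity (p.2 k) :=
      Finset.prod_nonneg fun k _ => mul_nonneg (Real.exp_pos _).le (specDensity_nonneg _)
    rw [Real.norm_eq_abs, abs_mul, abs_of_nonneg h0, Finset.abs_prod]
    gcongr with j _
    exact abs_siteFactor_le σ _ j _

/-- Integrating over the spectral variables gives the product of heat kernels. -/
theorem integral_spectral (δ : Fin (d + 1) → ℝ) (σ : Fin (d + 2) → ℝ) (x : Fin (d + 2) → ℝ) :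
    ∫ v : Fin (d + 1) → ℝ, (∏ j, siteFactor σ v j (x j)) *
        ∏ k, Real.exp (-(δ k * v k)) * specDensity (v k) =
      Real.exp (∑ j, σ j * x j) * ∏ k, heatKernel (δ k) (x k.castSucc) (x k.succ) := by
  simp only [prod_siteFactor, mul_assoc, ← Finset.prod_mul_distrib]
  rw [integral_const_mul, integral_fintype_prod_volume_eq_prod (fun k v =>
    besselK √v (Real.exp (x k.castSucc)) * (besselK √v (Real.exp (x k.succ)) *
      (Real.exp (-(δ k * v)) * specDensity v)))]
  congr 1
  refine Finset.prod_congr rfl fun k _ => ?_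
  rw [heatKernel_eq]
  refine integral_congr_ae (ae_of_all _ fun v => ?_)
  dsimp only
  ring

/-- Integrating over the positions gives the integrand of Gamma functions. -/
theorem integral_positions (δ : Fin (d + 1) → ℝ) (σ : Fin (d + 2) → ℝ) (v : Fin (d + 1) → ℝ) :
    ∫ x : Fin (d + 2) → ℝ, (∏ j, siteFactor σ v j (x j)) *
        ∏ k, Real.exp (-(δ k * v k)) * specDensity (v k) = dualIntegrand δ σ v := by
  rw [integral_mul_const, integral_fintype_prod_volume_eq_prod, dualIntegrand, mul_comm]
  rfl

theorem integrable_dualIntegrand {δ : Fin (d + 1) → ℝ} {σ : Fin (d + 2) → ℝ} (hδ : ∀ k, 0 < δ k)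
    (hσ : ∀ j, 0 < σ j) : Integrable (dualIntegrand δ σ) := by
  simpa only [integral_positions] using (integrable_chain hδ hσ).integral_prod_right

theorem integrable_exp_mul_prod_heatKernel {δ : Fin (d + 1) → ℝ} {σ : Fin (d + 2) → ℝ}
    (hδ : ∀ k, 0 < δ k) (hσ : ∀ j, 0 < σ j) :
    Integrable fun x : Fin (d + 2) → ℝ =>
      Real.exp (∑ j, σ j * x j) * ∏ k, heatKernel (δ k) (x k.castSucc) (x k.succ) := by
  simpa only [integral_spectral] using (integrable_chain hδ hσ).integral_prod_left

theorem integral_exp_mul_prod_heatKernel {δ : Fin (d + 1) → ℝ} {σ : Fin (d + 2) → ℝ}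
    (hδ : ∀ k, 0 < δ k) (hσ : ∀ j, 0 < σ j) :
    ∫ x : Fin (d + 2) → ℝ,
      Real.exp (∑ j, σ j * x j) * ∏ k, heatKernel (δ k) (x k.castSucc) (x k.succ) =
    ∫ v, dualIntegrand δ σ v := by
  have h := integral_integral_swap (f := fun (x : Fin (d + 2) → ℝ) (v : Fin (d + 1) → ℝ) =>
    (∏ j, siteFactor σ v j (x j)) * ∏ k, Real.exp (-(δ k * v k)) * specDensity (v k))
    (integrable_chain hδ hσ)
  simpa only [integral_spectral, integral_positions] using h

/-- Fixing the last spectral variable still leaves an integrable function, for every value. -/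
theorem integrable_dualIntegrand_snoc {δ : Fin (d + 1) → ℝ} {σ : Fin (d + 2) → ℝ}
    (hδ : ∀ k, 0 < δ k) (hσ : ∀ j, 0 < σ j) (x : ℝ) :
    Integrable fun y : Fin d → ℝ => dualIntegrand δ σ (Fin.snoc (α := fun _ => ℝ) y x) := by
  have h2 : Integrable fun y : Fin d → ℝ =>
      ∏ k : Fin d, Real.exp (-(δ k.castSucc * y k)) * specDensity (y k) :=
    Integrable.fintype_prod
      (f := fun (k : Fin d) v => Real.exp (-(δ k.castSucc * v)) * specDensity v)
      fun k => integrable_exp_mul_specDensity (hδ k.castSucc)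
  have h3 := h2.mul_const
    (Real.exp (-(δ (Fin.last d) * x)) * specDensity x * ∏ j, siteIntegral σ 0 j)
  refine h3.mono' (Measurable.aestronglyMeasurable ?_) (ae_of_all _ fun y => ?_)
  · refine (measurable_dualIntegrand δ σ).comp (measurable_pi_lambda _ fun k => ?_)
    refine Fin.lastCases ?_ (fun i => ?_) k
    · simp
    · simpa using measurable_pi_apply i
  · refine (abs_dualIntegrand_le hσ δ _).trans (le_of_eq ?_)
    rw [Fin.prod_univ_castSucc]
    simp [mul_assoc]

/-- Splitting off the last coordinate of `ℝ^(d+1)`. -/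
theorem integral_fin_snoc {f : (Fin (d + 1) → ℝ) → ℝ} (hf : Integrable f) :
    Integrable (fun x : ℝ => ∫ y : Fin d → ℝ, f (Fin.snoc (α := fun _ => ℝ) y x)) ∧
    ∫ x : ℝ, ∫ y : Fin d → ℝ, f (Fin.snoc (α := fun _ => ℝ) y x) = ∫ v, f v := by
  have hp := (volume_preserving_piFinSuccAbove (fun _ : Fin (d + 1) => ℝ) (Fin.last d)).symm
  have h1 := (hp.integrable_comp_emb (MeasurableEquiv.measurableEmbedding _)).2 hf
  have h2 := hp.integral_comp (MeasurableEquiv.measurableEmbedding _) f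
  have h3 : ∀ p : ℝ × (Fin d → ℝ),
      (MeasurableEquiv.piFinSuccAbove (fun _ : Fin (d + 1) => ℝ) (Fin.last d)).symm p =
        Fin.snoc (α := fun _ => ℝ) p.2 p.1 := by
    intro p
    simp only [MeasurableEquiv.piFinSuccAbove]
    simp [Fin.snocEquiv]
  have h4 : Integrable (fun p : ℝ × (Fin d → ℝ) => f (Fin.snoc (α := fun _ => ℝ) p.2 p.1))
      ((volume : Measure ℝ).prod volume) := by
    refine h1.congr (ae_of_all _ fun p => ?_)
    simp only [Function.comp]
    rw [h3]
  refine ⟨h4.integral_prod_left, ?_⟩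
  rw [← integral_prod _ h4, ← h2]
  refine integral_congr_ae (ae_of_all _ fun p => ?_)
  dsimp only
  rw [h3]

/-! ### The two sides of the duality -/

/-- The exponents `c - s_1`, `s_k - s_{k+1}`, `a + s_{d+1}` of the positions, obtained by summation
by parts in `c x_0 + a x_{d+1} + ∑ s_k (x_k - x_{k-1})`. -/
noncomputable def siteExponent (a c : ℝ) (s : Fin (d + 1) → ℝ) (j : Fin (d + 2)) : ℝ :=
  (Fin.cons (α := fun _ => ℝ) c s j : ℝ) - (Fin.snoc (α := fun _ => ℝ) s (-a) j : ℝ)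

theorem siteExponent_zero (a c : ℝ) (s : Fin (d + 1) → ℝ) : siteExponent a c s 0 = c - s 0 := by
  rw [siteExponent, Fin.cons_zero, ← Fin.castSucc_zero, Fin.snoc_castSucc]

theorem siteExponent_last (a c : ℝ) (s : Fin (d + 1) → ℝ) :
    siteExponent a c s (Fin.last _) = a + s (Fin.last _) := by
  rw [siteExponent, Fin.snoc_last, ← Fin.succ_last, Fin.cons_succ]
  ring

theorem siteExponent_mid (a c : ℝ) (s : Fin (d + 1) → ℝ) (k : Fin d) :
    siteExponent a c s k.castSucc.succ = s k.castSucc - s k.succ := by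
  rw [siteExponent, Fin.cons_succ, Fin.succ_castSucc, Fin.snoc_castSucc]

theorem siteExponent_pos {a c : ℝ} {s : Fin (d + 1) → ℝ} (hs : StrictAnti s) (hs_lt : s 0 < c)
    (hs_gt : -a < s (Fin.last d)) (j : Fin (d + 2)) : 0 < siteExponent a c s j := by
  refine forall_site (p := fun j => 0 < siteExponent a c s j) ?_ ?_ (fun k => ?_) j
  · rw [siteExponent_zero]
    linarith
  · rw [siteExponent_last]
    linarith
  · rw [siteExponent_mid]
    exact sub_pos.2 (hs (Fin.castSucc_lt_succ))

theorem sum_siteExponent (a c : ℝ) (s : Fin (d + 1) → ℝ) (x : Fin (d + 2) → ℝ) :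
    ∑ j, siteExponent a c s j * x j =
      (∑ k : Fin (d + 1), s k * (x k.succ - x k.castSucc)) + (c * x 0 + a * x (Fin.last _)) := by
  simp only [siteExponent, sub_mul, Finset.sum_sub_distrib, mul_sub]
  rw [Fin.sum_univ_succ, Fin.sum_univ_castSucc (fun j : Fin (d + 2) =>
    (Fin.snoc (α := fun _ => ℝ) s (-a) j : ℝ) * x j)]
  simp
  ring

theorem exp_mul_jointDensityY (a c τ : ℝ) (s : Fin (d + 1) → ℝ) (t x : Fin (d + 2) → ℝ) :
    Real.exp (∑ k : Fin (d + 1), s k * (x k.succ - x k.castSucc)) * jointDensityY a c τ t x =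
      (normConst a c τ)⁻¹ * (Real.exp (∑ j, siteExponent a c s j * x j) *
        ∏ k : Fin (d + 1), heatKernel (t k.succ - t k.castSucc) (x k.castSucc) (x k.succ)) := by
  rw [sum_siteExponent, jointDensityY, Real.exp_add (∑ k, _)]
  ring

theorem prod_castSucc_div_succ {R : Fin (d + 1) → ℝ} (hR : ∀ k, R k ≠ 0) :
    ∏ k : Fin d, R k.castSucc / R k.succ = R 0 / R (Fin.last d) := by
  rw [Finset.prod_div_distrib, div_eq_div_iff (Finset.prod_ne_zero_iff.2 fun k _ => hR _) (hR _),
    ← Fin.prod_univ_castSucc, ← Fin.prod_univ_succ]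

/-- The factor whose ratios at consecutive times appear in the transition densities; these ratios
telescope along a path. -/
noncomputable def telescopeFactor (c s x : ℝ) : ℝ :=
  gammaSq ((c - s) / 2) (√x / 2) * 2 ^ (-s)

theorem telescopeFactor_pos {c s : ℝ} (hs : s < c) (x : ℝ) : 0 < telescopeFactor c s x :=
  mul_pos (gammaSq_pos (by linarith) _) (Real.rpow_pos_of_pos two_pos _)

/-- A transition density is the spectral density times the Mellin transform of `K_{iu} K_{iv}`,
times a ratio that telescopes along a path. -/
theorem transDensity_eq {c s t : ℝ} (x : ℝ) {y : ℝ} (hy : 0 < y) :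
    transDensity c s t x y = specDensity y *
      (2 ^ (t - s - 3) / Real.Gamma (t - s) *
        (gammaSq ((t - s) / 2) ((√x + √y) / 2) * gammaSq ((t - s) / 2) ((√x - √y) / 2))) *
      (telescopeFactor c t y / telescopeFactor c s x) := by
  have h2 : (2 : ℝ) ^ (t - s - 3) = 2 ^ (-s) / 2 ^ (-t) / 8 := by
    rw [← Real.rpow_sub two_pos, show t - s - 3 = (-s - -t) - (3 : ℕ) by push_cast; ring,
      Real.rpow_sub_natCast two_ne_zero]
    norm_num
  have h3 : (2 : ℝ) ^ (-s) ≠ 0 := (Real.rpow_pos_of_pos two_pos _).ne'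
  have h4 : (2 : ℝ) ^ (-t) ≠ 0 := (Real.rpow_pos_of_pos two_pos _).ne'
  rw [transDensity, if_pos hy, specDensity_of_pos hy, h2, telescopeFactor, telescopeFactor]
  field_simp

theorem weightT_eq (a c τ s : ℝ) {x : ℝ} (hx : 0 < x) :
    weightT a c τ s x = (normConst a c τ)⁻¹ * (specDensity x *
      (2 ^ (c - 2) * (2 ^ (a + s - 2) * gammaSq ((a + s) / 2) (√x / 2)) *
        telescopeFactor c s x)) := by
  have h : (2 : ℝ) ^ (a + c) / 16 = 2 ^ (c - 2) * 2 ^ (a + s - 2) * 2 ^ (-s) := by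
    rw [← Real.rpow_add two_pos, ← Real.rpow_add two_pos,
      show c - 2 + (a + s - 2) + -s = a + c - (4 : ℕ) by push_cast; ring,
      Real.rpow_sub_natCast two_ne_zero]
    norm_num
  have h2 : weightT a c τ s x = (normConst a c τ)⁻¹ * (1 / (Real.pi * √x * gammaSq 0 √x) *
      (2 ^ (a + c) / 16 * (gammaSq ((a + s) / 2) (√x / 2) * gammaSq ((c - s) / 2) (√x / 2)))) := by
    rw [weightT]
    simp only [div_eq_mul_inv, mul_inv]
    ring
  rw [h2, h, specDensity_of_pos hx, telescopeFactor]
  ring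

/-- The identity of integrands behind the duality: after the transition densities telescope, the
path density of the continuous dual Hahn process, weighted by `weightT`, is the integrand in the
spectral variables. -/
theorem exp_mul_pathDensityT_mul {a c : ℝ} {s : Fin (d + 1) → ℝ} (hs : StrictAnti s)
    (hs_lt : s 0 < c) (hs_gt : -a < s (Fin.last d)) (δ : Fin (d + 1) → ℝ) (x : ℝ)
    (y : Fin d → ℝ) :
    Real.exp (-∑ k, δ k * Fin.snoc (α := fun _ => ℝ) y x k) * pathDensityT c s x y *
      (specDensity x * (2 ^ (c - 2) * (2 ^ (a + s (Fin.last d) - 2) *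
        gammaSq ((a + s (Fin.last d)) / 2) (√x / 2)) * telescopeFactor c (s (Fin.last d)) x)) =
    dualIntegrand δ (siteExponent a c s) (Fin.snoc (α := fun _ => ℝ) y x) := by
  have hσ := siteExponent_pos hs hs_lt hs_gt
  set z : Fin (d + 1) → ℝ := Fin.snoc (α := fun _ => ℝ) y x with hz
  have hzl : z (Fin.last d) = x := by simp [hz]
  have hzc : ∀ k : Fin d, z k.castSucc = y k := fun k => by simp [hz]
  have hsc : ∀ k, s k < c := fun k => (hs.antitone (Fin.zero_le k)).trans_lt hs_lt
  by_cases hy : ∀ k, 0 < y k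
  · have hT : pathDensityT c s x y = (∏ k : Fin d, specDensity (z k.castSucc)) *
        (∏ k : Fin d, siteIntegral (siteExponent a c s) z k.castSucc.succ) *
        (telescopeFactor c (s 0) (z 0) / telescopeFactor c (s (Fin.last d)) x) := by
      have h1 := prod_castSucc_div_succ (R := fun k => telescopeFactor c (s k) (z k))
        fun k => (telescopeFactor_pos (hsc k) _).ne'
      rw [hzl] at h1
      rw [← h1, ← Finset.prod_mul_distrib, ← Finset.prod_mul_distrib, pathDensityT]
      refine Finset.prod_congr rfl fun k _ => ?_
      rw [← hz, transDensity_eq _ (by rw [hzc]; exact hy k), siteIntegral_mid hσ,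
        siteExponent_mid]
    have hne := (telescopeFactor_pos (hsc (Fin.last d)) x).ne'
    rw [hT, dualIntegrand, Finset.prod_mul_distrib, Fin.prod_univ_castSucc (fun k =>
      specDensity (z k)), Fin.prod_univ_succ (fun j => siteIntegral _ z j),
      Fin.prod_univ_castSucc (fun j : Fin (d + 1) => siteIntegral _ z j.succ), Fin.succ_last,
      siteIntegral_zero hσ, siteIntegral_last hσ, siteExponent_zero, siteExponent_last, hzl,
      ← Finset.sum_neg_distrib, Real.exp_sum]
    have h5 : (2 : ℝ) ^ (c - s 0 - 2) = 2 ^ (c - 2) * 2 ^ (-s 0) := by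
      rw [← Real.rpow_add two_pos]
      ring_nf
    rw [h5, telescopeFactor.eq_def c (s 0)]
    field_simp
  -- outside the state space `(0, ∞)` both sides vanish
  · obtain ⟨k, hk⟩ := not_forall.1 hy
    have h1 : pathDensityT c s x y = 0 :=
      Finset.prod_eq_zero (Finset.mem_univ k) (by
        rw [← hz, hzc, transDensity, if_neg hk])
    have h2 : dualIntegrand δ (siteExponent a c s) z = 0 := by
      rw [dualIntegrand, Finset.prod_eq_zero (Finset.mem_univ k.castSucc), zero_mul]
      rw [hzc, specDensity_of_nonpos (not_lt.1 hk), mul_zero]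
    rw [h1, h2]
    ring

theorem specDensity_pos {v : ℝ} (hv : 0 < v) : 0 < specDensity v := by
  have hs : 0 < √v := Real.sqrt_pos.2 hv
  exact div_pos (Real.sinh_pos_iff.2 (by positivity)) (by positivity)

theorem integrable_exp_mul_pathDensityT {a c : ℝ} {s : Fin (d + 1) → ℝ} (hs : StrictAnti s)
    (hs_lt : s 0 < c) (hs_gt : -a < s (Fin.last d)) {δ : Fin (d + 1) → ℝ} (hδ : ∀ k, 0 < δ k)
    {x : ℝ} (hx : 0 < x) :
    Integrable fun y : Fin d → ℝ =>
      Real.exp (-∑ k, δ k * Fin.snoc (α := fun _ => ℝ) y x k) * pathDensityT c s x y := by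
  have h := integrable_dualIntegrand_snoc hδ (siteExponent_pos hs hs_lt hs_gt) x
  simp only [← exp_mul_pathDensityT_mul hs hs_lt hs_gt δ x] at h
  -- the weight without `normConst` is positive, so it can be divided out
  refine (integrable_mul_const_iff (IsUnit.mk0 _ (ne_of_gt ?_)) _).1 h
  have h1 := telescopeFactor_pos ((hs.antitone (Fin.zero_le (Fin.last d))).trans_lt hs_lt) x
  have h2 := gammaSq_pos (by linarith : 0 < (a + s (Fin.last d)) / 2) (√x / 2)
  have h3 := specDensity_pos hx
  positivity

theorem integral_pathDensityT_mul_weightT {a c : ℝ} (τ : ℝ) {s : Fin (d + 1) → ℝ}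
    (hs : StrictAnti s) (hs_lt : s 0 < c) (hs_gt : -a < s (Fin.last d)) (δ : Fin (d + 1) → ℝ)
    {x : ℝ} (hx : 0 < x) :
    (∫ y : Fin d → ℝ,
      Real.exp (-∑ k, δ k * Fin.snoc (α := fun _ => ℝ) y x k) * pathDensityT c s x y) *
        weightT a c τ (s (Fin.last d)) x =
    (normConst a c τ)⁻¹ * ∫ y : Fin d → ℝ, dualIntegrand δ (siteExponent a c s)
      (Fin.snoc (α := fun _ => ℝ) y x) := by
  rw [weightT_eq _ _ _ _ hx, mul_left_comm, ← integral_mul_const]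
  simp only [exp_mul_pathDensityT_mul hs hs_lt hs_gt δ x]

theorem dualIntegrand_snoc_of_nonpos (δ : Fin (d + 1) → ℝ) (σ : Fin (d + 2) → ℝ) {x : ℝ}
    (hx : x ≤ 0) (y : Fin d → ℝ) : dualIntegrand δ σ (Fin.snoc (α := fun _ => ℝ) y x) = 0 := by
  rw [dualIntegrand, Finset.prod_eq_zero (Finset.mem_univ (Fin.last d)), zero_mul]
  rw [Fin.snoc_last, specDensity_of_nonpos hx, mul_zero]

/-- The duality for the densities. -/
theorem duality_density {a c τ : ℝ} {s : Fin (d + 1) → ℝ} (hs : StrictAnti s)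
    (hs_lt : s 0 < c) (hs_gt : -a < s (Fin.last d)) {t : Fin (d + 2) → ℝ} (ht : StrictMono t) :
    IntegrableOn
      (fun x =>
        (∫ y : Fin d → ℝ, Real.exp (-∑ k : Fin (d + 1), (t k.succ - t k.castSucc) *
            Fin.snoc (α := fun _ => ℝ) y x k) * pathDensityT c s x y) *
          weightT a c τ (s (Fin.last d)) x) (Ioi 0) ∧
    Integrable (fun x : Fin (d + 2) → ℝ =>
      Real.exp (∑ k : Fin (d + 1), s k * (x k.succ - x k.castSucc)) * jointDensityY a c τ t x) ∧
    ∫ x in Ioi (0 : ℝ),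
        (∫ y : Fin d → ℝ, Real.exp (-∑ k : Fin (d + 1), (t k.succ - t k.castSucc) *
            Fin.snoc (α := fun _ => ℝ) y x k) * pathDensityT c s x y) *
          weightT a c τ (s (Fin.last d)) x =
      ∫ x : Fin (d + 2) → ℝ,
        Real.exp (∑ k : Fin (d + 1), s k * (x k.succ - x k.castSucc)) *
          jointDensityY a c τ t x := by
  have hσ := siteExponent_pos hs hs_lt hs_gt
  have hδ : ∀ k : Fin (d + 1), 0 < t k.succ - t k.castSucc := fun k =>
    sub_pos.2 (ht Fin.castSucc_lt_succ)
  obtain ⟨h1, h2⟩ := integral_fin_snoc (integrable_dualIntegrand hδ hσ)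
  simp only [exp_mul_jointDensityY]
  refine ⟨?_, (integrable_exp_mul_prod_heatKernel hδ hσ).const_mul _, ?_⟩
  · refine (h1.const_mul (normConst a c τ)⁻¹).integrableOn.congr_fun (fun x hx => ?_)
      measurableSet_Ioi
    exact (integral_pathDensityT_mul_weightT τ hs hs_lt hs_gt _ hx).symm
  · rw [setIntegral_congr_fun measurableSet_Ioi fun x hx =>
      integral_pathDensityT_mul_weightT τ hs hs_lt hs_gt _ hx, integral_const_mul,
      integral_const_mul, integral_exp_mul_prod_heatKernel hδ hσ, ← h2,
      setIntegral_eq_integral_of_forall_compl_eq_zero fun x hx => ?_]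
    simp only [dualIntegrand_snoc_of_nonpos _ _ (not_lt.1 hx), integral_zero]

/-! ### Expectations and densities -/

/-- Expectations of functions of a random vector with a density. -/
theorem HasDensity.integral_comp {Ω : Type*} [MeasurableSpace Ω] {P : Measure Ω}
    [IsFiniteMeasure P] {n : ℕ} {X : Ω → Fin n → ℝ} {f : (Fin n → ℝ) → ℝ} (h : HasDensity P X f)
    (hX : Measurable X) {g : (Fin n → ℝ) → ℝ} (hg : Measurable g)
    (hgf : Integrable fun x => g x * f x) :
    Integrable (fun ω => g (X ω)) P ∧ ∫ ω, g (X ω) ∂P = ∫ x, g x * f x := by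
  obtain ⟨hf, hB⟩ := h
  -- a density is nonnegative because its integrals are probabilities
  have hnn : 0 ≤ᵐ[volume] f := ae_nonneg_of_forall_setIntegral_nonneg hf fun B hBm _ => by
    rw [← hB B hBm]
    exact measureReal_nonneg
  have hmap : P.map X = volume.withDensity fun x => ENNReal.ofReal (f x) := by
    ext B hBm
    rw [Measure.map_apply hX hBm, withDensity_apply _ hBm,
      ← ofReal_integral_eq_lintegral_ofReal hf.integrableOn (ae_restrict_of_ae hnn), ← hB B hBm,
      ofReal_measureReal]
  have hfm : AEMeasurable (fun x => ENNReal.ofReal (f x)) volume := hf.aemeasurable.ennreal_ofReal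
  have hlt : ∀ᵐ x, ENNReal.ofReal (f x) < ⊤ := ae_of_all _ fun x => ENNReal.ofReal_lt_top
  have hcongr : (fun x => (ENNReal.ofReal (f x)).toReal • g x) =ᵐ[volume] fun x => g x * f x := by
    filter_upwards [hnn] with x hx
    rw [ENNReal.toReal_ofReal hx, smul_eq_mul, mul_comm]
  constructor
  · have h1 : Integrable g (P.map X) := by
      rw [hmap, integrable_withDensity_iff_integrable_smul₀' hfm hlt]
      exact hgf.congr hcongr.symm
    exact h1.comp_measurable hX
  · rw [← integral_map hX.aemeasurable hg.aestronglyMeasurable, hmap,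
      integral_withDensity_eq_integral_toReal_smul₀ hfm hlt]
    exact integral_congr_ae hcongr

/-- The conditional expectation in the duality, as an integral against the path density. -/
theorem IsProcessT.integral_exp {a c : ℝ} {Ω : Type*} [MeasurableSpace Ω] {Q : ℝ → ℝ → Measure Ω}
    {T : ℝ → Ω → ℝ} (hT : IsProcessT a c Q T) {s : Fin (d + 1) → ℝ} (hs : StrictAnti s)
    (hs_lt : s 0 < c) (hs_gt : -a < s (Fin.last d)) {δ : Fin (d + 1) → ℝ} (hδ : ∀ k, 0 < δ k)
    {x : ℝ} (hx : 0 < x) :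
    Integrable (fun ω => Real.exp (-∑ k, δ k * T (s k) ω)) (Q (s (Fin.last d)) x) ∧
    ∫ ω, Real.exp (-∑ k, δ k * T (s k) ω) ∂(Q (s (Fin.last d)) x) =
      ∫ y : Fin d → ℝ,
        Real.exp (-∑ k, δ k * Fin.snoc (α := fun _ => ℝ) y x k) * pathDensityT c s x y := by
  have hmem : ∀ k, s k ∈ Ioo (-a) c := fun k =>
    ⟨hs_gt.trans_le (hs.antitone (Fin.le_last k)), (hs.antitone (Fin.zero_le k)).trans_lt hs_lt⟩
  have := hT.isProb _ (hmem (Fin.last d)) x hx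
  have hg : Measurable fun y : Fin d → ℝ =>
      Real.exp (-∑ k, δ k * Fin.snoc (α := fun _ => ℝ) y x k) := by
    simp only [Fin.sum_univ_castSucc, Fin.snoc_castSucc, Fin.snoc_last]
    fun_prop
  obtain ⟨h1, h2⟩ := (hT.fdd d s hs hmem x hx).integral_comp
    (measurable_pi_lambda _ fun k => hT.measurable _ (hmem _)) hg
    (integrable_exp_mul_pathDensityT hs hs_lt hs_gt hδ hx)
  have h3 : (fun ω => Real.exp (-∑ k, δ k * Fin.snoc (α := fun _ => ℝ)
      (fun k : Fin d => T (s k.castSucc) ω) x k)) =ᵐ[Q (s (Fin.last d)) x]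
      fun ω => Real.exp (-∑ k, δ k * T (s k) ω) := by
    filter_upwards [hT.start _ (hmem (Fin.last d)) x hx] with ω hω
    simp only [Fin.sum_univ_castSucc, Fin.snoc_castSucc, Fin.snoc_last, hω]
  exact ⟨h1.congr h3, by rw [← h2, integral_congr_ae h3]⟩

/-- The expectation of the exponential functional of `Y`, as an integral against the joint
density. -/
theorem IsProcessY.integral_exp {a c τ : ℝ} {Ω : Type*} [MeasurableSpace Ω] {P : Measure Ω}
    {Y : ℝ → Ω → ℝ} (hY : IsProcessY a c τ P Y) {s : Fin (d + 1) → ℝ} (hs : StrictAnti s)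
    (hs_lt : s 0 < c) (hs_gt : -a < s (Fin.last d)) {t : Fin (d + 2) → ℝ} (ht : StrictMono t)
    (ht_zero : t 0 = 0) (ht_last : t (Fin.last (d + 1)) = τ) :
    Integrable (fun ω => Real.exp (∑ k, s k * (Y (t k.succ) ω - Y (t k.castSucc) ω))) P ∧
    ∫ ω, Real.exp (∑ k, s k * (Y (t k.succ) ω - Y (t k.castSucc) ω)) ∂P =
      ∫ x : Fin (d + 2) → ℝ,
        Real.exp (∑ k : Fin (d + 1), s k * (x k.succ - x k.castSucc)) *
          jointDensityY a c τ t x := by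
  have := hY.isProb
  refine (hY.fdd d t ht ht_zero ht_last).integral_comp
    (g := fun x => Real.exp (∑ k : Fin (d + 1), s k * (x k.succ - x k.castSucc)))
    (measurable_pi_lambda _ fun k => hY.measurable _ ⟨?_, ?_⟩) (by fun_prop)
    (duality_density hs hs_lt hs_gt ht).2.1
  · rw [← ht_zero]
    exact ht.monotone (Fin.zero_le k)
  · rw [← ht_last]
    exact ht.monotone (Fin.le_last k)

end DualRep

theorem mainTheorem3 (a c τ : ℝ) (hac : 0 < a + c) (d : ℕ)
    (s : Fin (d + 1) → ℝ) (hs : StrictAnti s) (hs_lt : s 0 < c) (hs_gt : -a < s (Fin.last d))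
    (t : Fin (d + 2) → ℝ) (ht : StrictMono t) (ht_zero : t 0 = 0)
    (ht_last : t (Fin.last (d + 1)) = τ) :
    -- the identity for the processes
    (∀ (Ω : Type*) [MeasurableSpace Ω] (P : Measure Ω) (Y : ℝ → Ω → ℝ)
        (Ω' : Type*) [MeasurableSpace Ω'] (Q : ℝ → ℝ → Measure Ω') (T : ℝ → Ω' → ℝ),
      DualRep.IsProcessY a c τ P Y → DualRep.IsProcessT a c Q T →
      (∀ x : ℝ, 0 < x →
        Integrable (fun ω => Real.exp (-∑ k, (t k.succ - t k.castSucc) * T (s k) ω))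
          (Q (s (Fin.last d)) x)) ∧
      IntegrableOn
        (fun x =>
          (∫ ω, Real.exp (-∑ k, (t k.succ - t k.castSucc) * T (s k) ω) ∂(Q (s (Fin.last d)) x)) *
            DualRep.weightT a c τ (s (Fin.last d)) x) (Ioi 0) ∧
      Integrable (fun ω => Real.exp (∑ k, s k * (Y (t k.succ) ω - Y (t k.castSucc) ω))) P ∧
      ∫ x in Ioi (0 : ℝ),
          (∫ ω, Real.exp (-∑ k, (t k.succ - t k.castSucc) * T (s k) ω) ∂(Q (s (Fin.last d)) x)) *
            DualRep.weightT a c τ (s (Fin.last d)) x =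
        ∫ ω, Real.exp (∑ k, s k * (Y (t k.succ) ω - Y (t k.castSucc) ω)) ∂P) ∧
    -- the same identity with both expectations written out by the densities
    (∀ x : ℝ, 0 < x →
      Integrable (fun y : Fin d → ℝ =>
        Real.exp (-∑ k : Fin (d + 1), (t k.succ - t k.castSucc) *
            Fin.snoc (α := fun _ => ℝ) y x k) * DualRep.pathDensityT c s x y)) ∧
    IntegrableOn
      (fun x =>
        (∫ y : Fin d → ℝ, Real.exp (-∑ k : Fin (d + 1), (t k.succ - t k.castSucc) *
            Fin.snoc (α := fun _ => ℝ) y x k) * DualRep.pathDensityT c s x y) *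
          DualRep.weightT a c τ (s (Fin.last d)) x) (Ioi 0) ∧
    Integrable (fun x : Fin (d + 2) → ℝ =>
      Real.exp (∑ k : Fin (d + 1), s k * (x k.succ - x k.castSucc)) *
        DualRep.jointDensityY a c τ t x) ∧
    ∫ x in Ioi (0 : ℝ),
        (∫ y : Fin d → ℝ, Real.exp (-∑ k : Fin (d + 1), (t k.succ - t k.castSucc) *
            Fin.snoc (α := fun _ => ℝ) y x k) * DualRep.pathDensityT c s x y) *
          DualRep.weightT a c τ (s (Fin.last d)) x =
      ∫ x : Fin (d + 2) → ℝ,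
        Real.exp (∑ k : Fin (d + 1), s k * (x k.succ - x k.castSucc)) *
          DualRep.jointDensityY a c τ t x := by
  have hδ : ∀ k : Fin (d + 1), 0 < t k.succ - t k.castSucc := fun k =>
    sub_pos.2 (ht Fin.castSucc_lt_succ)
  have hD := DualRep.duality_density (τ := τ) hs hs_lt hs_gt ht
  refine ⟨fun Ω _ P Y Ω' _ Q T hY hT => ?_,
    fun x hx => DualRep.integrable_exp_mul_pathDensityT hs hs_lt hs_gt hδ hx, hD⟩
  have hT2 := fun x (hx : x ∈ Ioi (0 : ℝ)) => hT.integral_exp hs hs_lt hs_gt hδ hx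
  obtain ⟨hY1, hY2⟩ := hY.integral_exp hs hs_lt hs_gt ht ht_zero ht_last
  refine ⟨fun x hx => (hT2 x hx).1, ?_, hY1, ?_⟩
  · refine hD.1.congr_fun (fun x hx => ?_) measurableSet_Ioi
    dsimp only
    rw [(hT2 x hx).2]
  · rw [hY2, ← hD.2.2]
    refine setIntegral_congr_fun measurableSet_Ioi fun x hx => ?_
    rw [(hT2 x hx).2]
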